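/- Let $(M,g)$ and $(N,g_N)$ be smooth Riemannian manifolds and let $\pi:(M,g)\to (N,g_N)$ be a Riemannian submersion, that is, a smooth submersion such that $d\pi_x$ is isometric on the horizontal space $H_x=\mathcal V_x^{\perp_g}$, where $\mathcal V_x=\ker d\pi_x$ is the vertical space. Assume that the fibers of $\pi$ are totally geodesic, i.e. $\nabla_UW$ is vertical for all vertical vector fields $U,W$, where $\nabla$ is the Levi-Civita connection of $g$. Let $J$ be a complex structure on $M$, compatible with $g$, such that $(M,g,J)$ is Kähler (that is, $J^2=-1$, $g(J\cdot,J\cdot)=g$ and $\nabla J=0$), and assume that $J$ preserves both $\mathcal V$ and $H$. Let $\hat g$ be the Riemannian metric on $M$ with $$\hat g=\tfrac12 g \text{ on } \mathcal V,\qquad \hat g=g \text{ on } H,\qquad \hat g(\mathcal V,H)=0,$$ and let $\hat J$ be the almost complex structure with $\hat J|_{\mathcal V}=-J|_{\mathcal V}$ and $\hat J|_{H}=J|_{H}$. Let $\hat\nabla$ be the Levi-Civita connection of $\hat g$. Then: 1. $(M,\hat g,\hat J)$ is nearly Kähler: it is almost Hermitian ($\hat J$ is smooth, $\hat J^2=-1$,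 $\hat g(\hat J\cdot,\hat J\cdot)=\hat g$) and $(\hat\nabla_X\hat J)X=0$ for every vector field $X$ on $M$. 2. The distributions $\mathcal V$ and $H$ are parallel with respect to the canonical Hermitian connection $\overline\nabla_XY=\hat\nabla_XY+\tfrac12(\hat\nabla_X\hat J)\hat JY$ of $(M,\hat g,\hat J)$: if $Y$ is a section of $\mathcal V$ (respectively $H$), then so is $\overline\nabla_XY$ for every vector field $X$. 3. Consequently $\overline\nabla$ has reduced holonomy: for every $x\in M$ the holonomy group of $\overline\nabla$ at $x$ preserves the subspaces $\mathcal V_x$ and $H_x$ of $T_xM$. In particular, if $0<\dim N<\dim M$, the holonomy representation on $T_xM$ is reducible for every $x\in M$. -/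

import Mathlib

open Bundle FiberBundle VectorField
open scoped Manifold ContDiff


noncomputable section

variable {E : Type*} [NormedAddCommGroup E] [NormedSpace ℝ E] [FiniteDimensional ℝ E]
  {M : Type*} [TopologicalSpace M] [ChartedSpace E M] [IsManifold 𝓘(ℝ, E) ∞ M]
  {EN : Type*} [NormedAddCommGroup EN] [NormedSpace ℝ EN] [FiniteDimensional ℝ EN]
  {N : Type*} [TopologicalSpace N] [ChartedSpace EN N] [IsManifold 𝓘(ℝ, EN) ∞ N]

/-! ### Riemannian metrics and the Levi-Civita connection -/

/-- A smooth Riemannian metric on the manifold `M`. -/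
abbrev RiemMetric (E : Type*) [NormedAddCommGroup E] [NormedSpace ℝ E]
    (M : Type*) [TopologicalSpace M] [ChartedSpace E M] [IsManifold 𝓘(ℝ, E) ∞ M] :=
  ContMDiffRiemannianMetric 𝓘(ℝ, E) ∞ E (fun x : M => TangentSpace 𝓘(ℝ, E) x)

/-- A connection on the tangent bundle of `M`, sending a vector field `Y` to `X ↦ ∇_X Y`
(Mathlib writes `D Y x u` for `∇_u Y`, where `u` is a tangent vector at `x`). -/
abbrev AffineConnection (E : Type*) [NormedAddCommGroup E] [NormedSpace ℝ E]
    (M : Type*) [TopologicalSpace M] [ChartedSpace E M] [IsManifold 𝓘(ℝ, E) ∞ M] :=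
  CovariantDerivative 𝓘(ℝ, E) E (fun x : M => TangentSpace 𝓘(ℝ, E) x)

/-- `D` is the Levi-Civita connection of `g`: it has no torsion and preserves `g`. -/
structure IsLeviCivita (g : RiemMetric E M) (D : AffineConnection E M) : Prop where
  torsion_eq_zero : D.torsion = 0
  metric : ∀ (x : M) (Y Z : Π y : M, TangentSpace 𝓘(ℝ, E) y) (u : TangentSpace 𝓘(ℝ, E) x),
    MDiffAt (T% Y) x → MDiffAt (T% Z) x →
    d% (fun y => g.inner y (Y y) (Z y)) x u
      = g.inner x (D Y x u) (Z x) + g.inner x (Y x) (D Z x u)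

/-- The right-hand side of the Koszul formula for `2 g(∇_X Y, Z)` at `x`. -/
def koszul (g : RiemMetric E M) (Y X Z : Π y : M, TangentSpace 𝓘(ℝ, E) y) (x : M) : ℝ :=
  d% (fun y => g.inner y (Y y) (Z y)) x (X x) + d% (fun y => g.inner y (X y) (Z y)) x (Y x)
    - d% (fun y => g.inner y (X y) (Y y)) x (Z x)
    + g.inner x (mlieBracket 𝓘(ℝ, E) X Y x) (Z x)
    - g.inner x (mlieBracket 𝓘(ℝ, E) X Z x) (Y x)
    - g.inner x (mlieBracket 𝓘(ℝ, E) Y Z x) (X x)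

theorem RiemMetric.mdiffAt (g : RiemMetric E M) {x : M} {Y Z : Π y : M, TangentSpace 𝓘(ℝ, E) y}
    (hY : MDiffAt (T% Y) x) (hZ : MDiffAt (T% Z) x) :
    MDiffAt (fun y => g.inner y (Y y) (Z y)) x := by
  let _ : RiemannianBundle (fun x : M => TangentSpace 𝓘(ℝ, E) x) := ⟨g.toRiemannianMetric⟩
  exact MDifferentiableAt.inner_bundle (F := E) (E := fun x : M => TangentSpace 𝓘(ℝ, E) x) hY hZ

theorem koszul_tensorial_left (g : RiemMetric E M) {Y Z : Π y : M, TangentSpace 𝓘(ℝ, E) y} {x : M}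
    (hY : MDiffAt (T% Y) x) (hZ : MDiffAt (T% Z) x) :
    TensorialAt 𝓘(ℝ, E) E (fun X => koszul g Y X Z x) x where
  smul {f X} hf hX := by
    have h1 : d% (fun y => g.inner y ((f • X) y) (Z y)) x =
      d% (fun y => f y * g.inner y (X y) (Z y)) x := by simp
    have h2 : d% (fun y => g.inner y ((f • X) y) (Y y)) x =
      d% (fun y => f y * g.inner y (X y) (Y y)) x := by simp
    simp only [koszul, h1, h2]
    rw [mvfderiv_fun_mul hf (g.mdiffAt hX hZ), mvfderiv_fun_mul hf (g.mdiffAt hX hY),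
      mlieBracket_smul_left hf hX, mlieBracket_smul_left hf hX]
    simp
    ring
  add {X X'} hX hX' := by
    have h1 : d% (fun y => g.inner y ((X + X') y) (Z y)) x =
      d% (fun y => g.inner y (X y) (Z y) + g.inner y (X' y) (Z y)) x := by simp
    have h2 : d% (fun y => g.inner y ((X + X') y) (Y y)) x =
      d% (fun y => g.inner y (X y) (Y y) + g.inner y (X' y) (Y y)) x := by simp
    simp only [koszul, h1, h2]
    rw [mvfderiv_fun_add (g.mdiffAt hX hZ) (g.mdiffAt hX' hZ),
      mvfderiv_fun_add (g.mdiffAt hX hY) (g.mdiffAt hX' hY),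
      mlieBracket_add_left hX hX', mlieBracket_add_left hX hX']
    simp
    ring

theorem koszul_tensorial_right (g : RiemMetric E M) {Y X : Π y : M, TangentSpace 𝓘(ℝ, E) y} {x : M}
    (hY : MDiffAt (T% Y) x) (hX : MDiffAt (T% X) x) :
    TensorialAt 𝓘(ℝ, E) E (fun Z => koszul g Y X Z x) x where
  smul {f Z} hf hZ := by
    have h1 : d% (fun y => g.inner y (Y y) ((f • Z) y)) x =
      d% (fun y => f y * g.inner y (Y y) (Z y)) x := by simp
    have h2 : d% (fun y => g.inner y (X y) ((f • Z) y)) x =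
      d% (fun y => f y * g.inner y (X y) (Z y)) x := by simp
    simp only [koszul, h1, h2]
    rw [mvfderiv_fun_mul hf (g.mdiffAt hY hZ), mvfderiv_fun_mul hf (g.mdiffAt hX hZ),
      mlieBracket_smul_right hf hZ, mlieBracket_smul_right hf hZ]
    simp [g.symm x (Z x) (X x), g.symm x (Z x) (Y x)]
    ring
  add {Z Z'} hZ hZ' := by
    have h1 : d% (fun y => g.inner y (Y y) ((Z + Z') y)) x =
      d% (fun y => g.inner y (Y y) (Z y) + g.inner y (Y y) (Z' y)) x := by simp
    have h2 : d% (fun y => g.inner y (X y) ((Z + Z') y)) x =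
      d% (fun y => g.inner y (X y) (Z y) + g.inner y (X y) (Z' y)) x := by simp
    simp only [koszul, h1, h2]
    rw [mvfderiv_fun_add (g.mdiffAt hY hZ) (g.mdiffAt hY hZ'),
      mvfderiv_fun_add (g.mdiffAt hX hZ) (g.mdiffAt hX hZ'),
      mlieBracket_add_right hZ hZ', mlieBracket_add_right hZ hZ']
    simp
    ring

theorem RiemMetric.ext_inner (g : RiemMetric E M) {x : M} {u v : TangentSpace 𝓘(ℝ, E) x}
    (h : ∀ w, g.inner x u w = g.inner x v w) : u = v := by
  by_contra hne
  have := g.pos x (u - v) (sub_ne_zero.2 hne)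
  have e : g.inner x (u - v) (u - v) = 0 := by
    rw [map_sub (g.inner x) u v, sub_apply, h, sub_self]
  exact this.ne' e

/-- Riesz representation of a bilinear form. -/
theorem RiemMetric.exists_represent (g : RiemMetric E M) {x : M}
    (B : TangentSpace 𝓘(ℝ, E) x →L[ℝ] TangentSpace 𝓘(ℝ, E) x →L[ℝ] ℝ) :
    ∃ L : TangentSpace 𝓘(ℝ, E) x →L[ℝ] TangentSpace 𝓘(ℝ, E) x,
      ∀ u w, g.inner x (L u) w = B u w := by
  have : FiniteDimensional ℝ (TangentSpace 𝓘(ℝ, E) x) := inferInstanceAs (FiniteDimensional ℝ E)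
  have : T2Space (TangentSpace 𝓘(ℝ, E) x) := inferInstanceAs (T2Space E)
  let G : TangentSpace 𝓘(ℝ, E) x →ₗ[ℝ] Module.Dual ℝ (TangentSpace 𝓘(ℝ, E) x) :=
    (ContinuousLinearMap.coeLM ℝ).comp (g.inner x).toLinearMap
  let B' : TangentSpace 𝓘(ℝ, E) x →ₗ[ℝ] Module.Dual ℝ (TangentSpace 𝓘(ℝ, E) x) :=
    (ContinuousLinearMap.coeLM ℝ).comp B.toLinearMap
  have hG : Function.Injective G := fun u v h => g.ext_inner fun w => congr($h w)
  let e := LinearEquiv.ofInjectiveOfFinrankEq G hG (Subspace.dual_finrank_eq).symm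
  have he : ∀ f w, g.inner x (e.symm f) w = f w := fun f w => by
    have : G (e.symm f) = f := e.apply_symm_apply f
    exact congr($this w)
  exact ⟨LinearMap.toContinuousLinearMap (e.symm.toLinearMap.comp B'), fun u w => he _ _⟩

theorem exists_koszul (g : RiemMetric E M) {Y : Π y : M, TangentSpace 𝓘(ℝ, E) y} {x : M}
    (hY : MDiffAt (T% Y) x) :
    ∃ L : TangentSpace 𝓘(ℝ, E) x →L[ℝ] TangentSpace 𝓘(ℝ, E) x,
      ∀ X Z : Π y : M, TangentSpace 𝓘(ℝ, E) y, MDiffAt (T% X) x → MDiffAt (T% Z) x →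
        2 * g.inner x (L (X x)) (Z x) = koszul g Y X Z x := by
  obtain ⟨L, hL⟩ := g.exists_represent ((1 / 2 : ℝ) • TensorialAt.mkHom₂
    (fun X Z => koszul g Y X Z x) x (fun Z hZ => koszul_tensorial_left g hY hZ)
    (fun X hX => koszul_tensorial_right g hY hX))
  refine ⟨L, fun X Z hX hZ => ?_⟩
  have h := TensorialAt.mkHom₂_apply (Φ := fun X Z => koszul g Y X Z x)
    (fun Z hZ => koszul_tensorial_left g hY hZ)
    (fun X hX => koszul_tensorial_right g hY hX) hX hZ
  rw [hL, ← h]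
  simp

theorem IsLeviCivita.koszul_eq {g : RiemMetric E M} {D : AffineConnection E M}
    (h : IsLeviCivita g D) {x : M} {Y X Z : Π y : M, TangentSpace 𝓘(ℝ, E) y}
    (hY : MDiffAt (T% Y) x) (hX : MDiffAt (T% X) x) (hZ : MDiffAt (T% Z) x) :
    2 * g.inner x (D Y x (X x)) (Z x) = koszul g Y X Z x := by
  have ht : ∀ {X Y : Π y : M, TangentSpace 𝓘(ℝ, E) y} {x : M}, MDiffAt (T% X) x →
      MDiffAt (T% Y) x → D Y x (X x) - D X x (Y x) = mlieBracket 𝓘(ℝ, E) X Y x :=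
    D.torsion_eq_zero_iff.1 h.torsion_eq_zero
  simp only [koszul, ← ht hX hY, ← ht hX hZ, ← ht hY hZ, h.metric x _ _ _ hY hZ,
    h.metric x _ _ _ hX hZ, h.metric x _ _ _ hX hY, map_sub, sub_apply]
  rw [g.symm x (Y x) (D Z x (X x)), g.symm x (X x) (D Z x (Y x)), g.symm x (X x) (D Y x (Z x))]
  ring

/-- The fundamental theorem of Riemannian geometry (uniqueness part). -/
theorem IsLeviCivita.unique {g : RiemMetric E M} {D D' : AffineConnection E M}
    (h : IsLeviCivita g D) (h' : IsLeviCivita g D') {x : M}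
    {Y : Π y : M, TangentSpace 𝓘(ℝ, E) y} (hY : MDiffAt (T% Y) x) : D Y x = D' Y x := by
  ext u
  refine g.ext_inner fun w => ?_
  have e := (h.koszul_eq hY (mdifferentiableAt_extend 𝓘(ℝ, E) E u)
    (mdifferentiableAt_extend 𝓘(ℝ, E) E w)).trans
    (h'.koszul_eq hY (mdifferentiableAt_extend 𝓘(ℝ, E) E u)
    (mdifferentiableAt_extend 𝓘(ℝ, E) E w)).symm
  simpa using e

/-- The fundamental theorem of Riemannian geometry (existence part). -/
theorem exists_isLeviCivita (g : RiemMetric E M) : ∃ D : AffineConnection E M, IsLeviCivita g D := by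
  classical
  let D : (Π x : M, TangentSpace 𝓘(ℝ, E) x) →
      (Π x : M, TangentSpace 𝓘(ℝ, E) x →L[ℝ] TangentSpace 𝓘(ℝ, E) x) :=
    fun Y x => if h : MDiffAt (T% Y) x then (exists_koszul g h).choose else 0
  have hD : ∀ {x : M} {Y X Z : Π y : M, TangentSpace 𝓘(ℝ, E) y}, MDiffAt (T% Y) x →
      MDiffAt (T% X) x → MDiffAt (T% Z) x →
      2 * g.inner x (D Y x (X x)) (Z x) = koszul g Y X Z x := by
    intro x Y X Z hY hX hZ
    simp only [D, dif_pos hY]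
    exact (exists_koszul g hY).choose_spec X Z hX hZ
  have hext : ∀ {x : M} {A B : TangentSpace 𝓘(ℝ, E) x →L[ℝ] TangentSpace 𝓘(ℝ, E) x},
      (∀ X Z : Π y : M, TangentSpace 𝓘(ℝ, E) y, MDiffAt (T% X) x → MDiffAt (T% Z) x →
        2 * g.inner x (A (X x)) (Z x) = 2 * g.inner x (B (X x)) (Z x)) → A = B := by
    intro x A B h
    ext u
    refine g.ext_inner fun w => ?_
    have := h (extend E u) (extend E w) (mdifferentiableAt_extend ..) (mdifferentiableAt_extend ..)
    simpa using this
  have hcov : IsCovariantDerivativeOn E D Set.univ :=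
  { add := by
      intro Y Y' x hY hY' _
      refine hext fun X Z hX hZ => ?_
      have h1 : d% (fun y => g.inner y ((Y + Y') y) (Z y)) x =
        d% (fun y => g.inner y (Y y) (Z y) + g.inner y (Y' y) (Z y)) x := by simp
      have h2 : d% (fun y => g.inner y (X y) ((Y + Y') y)) x =
        d% (fun y => g.inner y (X y) (Y y) + g.inner y (X y) (Y' y)) x := by simp
      have e1 := hD hY hX hZ
      have e2 := hD hY' hX hZ
      rw [hD (mdifferentiableAt_add_section hY hY') hX hZ]
      simp only [add_apply, map_add, mul_add, e1, e2]
      simp only [koszul, h1, h2]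
      rw [mvfderiv_fun_add (g.mdiffAt hY hZ) (g.mdiffAt hY' hZ),
        mvfderiv_fun_add (g.mdiffAt hX hY) (g.mdiffAt hX hY'),
        mlieBracket_add_right hY hY', mlieBracket_add_left hY hY']
      simp
      ring
    leibniz := by
      intro Y f x hY hf _
      refine hext fun X Z hX hZ => ?_
      have h1 : d% (fun y => g.inner y ((f • Y) y) (Z y)) x =
        d% (fun y => f y * g.inner y (Y y) (Z y)) x := by simp
      have h2 : d% (fun y => g.inner y (X y) ((f • Y) y)) x =
        d% (fun y => f y * g.inner y (X y) (Y y)) x := by simp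
      have e1 := hD hY hX hZ
      rw [hD (hf.smul_section hY) hX hZ]
      have e3 : 2 * g.inner x ((f x • D Y x + (d% f x).smulRight (Y x)) (X x)) (Z x)
          = f x * koszul g Y X Z x + 2 * (d% f x (X x)) * g.inner x (Y x) (Z x) := by
        rw [← e1]; simp; ring
      rw [e3]
      simp only [koszul, h1, h2]
      rw [mvfderiv_fun_mul hf (g.mdiffAt hY hZ), mvfderiv_fun_mul hf (g.mdiffAt hX hY),
        mlieBracket_smul_right hf hY, mlieBracket_smul_left hf hY]
      simp [g.symm x (Y x) (X x)]
      ring }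
  refine ⟨⟨D, hcov⟩, ?_, ?_⟩
  · rw [CovariantDerivative.torsion_eq_zero_iff]
    intro X Y x hX hY
    refine g.ext_inner fun w => ?_
    have hw : MDiffAt (T% (extend E w : Π y : M, TangentSpace 𝓘(ℝ, E) y)) x :=
      mdifferentiableAt_extend ..
    have e1 := hD hY hX hw
    have e2 := hD hX hY hw
    simp only [extend_apply_self] at e1 e2
    have hs : (fun y => g.inner y (X y) (Y y)) = fun y => g.inner y (Y y) (X y) :=
      funext fun y => g.symm ..
    simp only [koszul, hs, extend_apply_self] at e1 e2
    rw [mlieBracket_swap_apply (V := Y) (W := X)] at e2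
    simp only [map_sub, map_neg, sub_apply, neg_apply]
      at e1 e2 ⊢
    change g.inner x (D Y x (X x)) w - g.inner x (D X x (Y x)) w = _
    linarith
  · intro x Y Z u hY hZ
    have hu : MDiffAt (T% (extend E u : Π y : M, TangentSpace 𝓘(ℝ, E) y)) x :=
      mdifferentiableAt_extend ..
    have e1 := hD hY hu hZ
    have e2 := hD hZ hu hY
    have hs : (fun y => g.inner y (Z y) (Y y)) = fun y => g.inner y (Y y) (Z y) :=
      funext fun y => g.symm ..
    simp only [koszul, hs, extend_apply_self] at e1 e2
    rw [mlieBracket_swap_apply (V := Z) (W := Y)] at e2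
    simp only [map_neg, neg_apply] at e1 e2
    change _ = g.inner x (D Y x u) (Z x) + g.inner x (Y x) (D Z x u)
    rw [g.symm x (Y x) (D Z x u)]
    linarith
/-- The Levi-Civita connection of `g`. By `IsLeviCivita.unique` the choice is immaterial on
differentiable vector fields, and it is never used on others. -/
def leviCivita (g : RiemMetric E M) : AffineConnection E M := (exists_isLeviCivita g).choose

/-! ### Almost Hermitian structures -/

/-- A field of endomorphisms of the tangent spaces of `M`. -/
abbrev EndField (E : Type*) [NormedAddCommGroup E] [NormedSpace ℝ E]
    (M : Type*) [TopologicalSpace M] [ChartedSpace E M] :=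
  Π x : M, TangentSpace 𝓘(ℝ, E) x →L[ℝ] TangentSpace 𝓘(ℝ, E) x

/-- `(M, g, J)` is almost Hermitian: `J` is a smooth field of endomorphisms with `J² = -1`,
and `g` is `J`-invariant. -/
structure IsAlmostHermitian (g : RiemMetric E M) (J : EndField E M) : Prop where
  smooth : ContMDiff 𝓘(ℝ, E) (𝓘(ℝ, E).prod 𝓘(ℝ, E →L[ℝ] E)) ∞
    (fun x => TotalSpace.mk' (E →L[ℝ] E)
      (E := fun x : M => TangentSpace 𝓘(ℝ, E) x →L[ℝ] TangentSpace 𝓘(ℝ, E) x) x (J x))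
  sq : ∀ x u, J x (J x u) = -u
  compatible : ∀ x u v, g.inner x (J x u) (J x v) = g.inner x u v

/-- The covariant derivative of `J`: `covDerivEnd D J Y x u` is
`(∇_u J) Y = ∇_u (J Y) - J (∇_u Y)` at the point `x`. -/
def covDerivEnd (D : AffineConnection E M) (J : EndField E M)
    (Y : Π y : M, TangentSpace 𝓘(ℝ, E) y) (x : M) :
    TangentSpace 𝓘(ℝ, E) x →L[ℝ] TangentSpace 𝓘(ℝ, E) x :=
  D (fun y => J y (Y y)) x - (J x).comp (D Y x)

/-- `(M, g, J)` is Kähler: it is almost Hermitian and `∇J = 0`. -/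
structure IsKahler (g : RiemMetric E M) (J : EndField E M) : Prop where
  almostHermitian : IsAlmostHermitian g J
  parallel : ∀ (x : M) (Y : Π y : M, TangentSpace 𝓘(ℝ, E) y), MDiffAt (T% Y) x →
    covDerivEnd (leviCivita g) J Y x = 0

/-- `(M, g, J)` is nearly Kähler: it is almost Hermitian and `(∇_X J) X = 0` for all `X`. -/
structure IsNearlyKahler (g : RiemMetric E M) (J : EndField E M) : Prop where
  almostHermitian : IsAlmostHermitian g J
  skew : ∀ (x : M) (X : Π y : M, TangentSpace 𝓘(ℝ, E) y), MDiffAt (T% X) x →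
    covDerivEnd (leviCivita g) J X x (X x) = 0

/-- The canonical Hermitian connection `Y ↦ (X ↦ ∇_X Y + (1/2) (∇_X J) J Y)` of `(M, g, J)`. -/
def canonicalHermitian (g : RiemMetric E M) (J : EndField E M)
    (Y : Π y : M, TangentSpace 𝓘(ℝ, E) y) (x : M) :
    TangentSpace 𝓘(ℝ, E) x →L[ℝ] TangentSpace 𝓘(ℝ, E) x :=
  leviCivita g Y x + (1 / 2 : ℝ) • covDerivEnd (leviCivita g) J (fun y => J y (Y y)) x

/-! ### Parallel distributions, parallel transport and holonomy -/

/-- The distribution `S` is parallel for the connection `D`: if `Y` is a section of `S` and `u` a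
tangent vector, then `∇_u Y` lies in `S`. -/
def IsParallelDistribution
    (D : (Π y : M, TangentSpace 𝓘(ℝ, E) y) → EndField E M)
    (S : Π x : M, Submodule ℝ (TangentSpace 𝓘(ℝ, E) x)) : Prop :=
  ∀ (x : M) (Y : Π y : M, TangentSpace 𝓘(ℝ, E) y), MDiffAt (T% Y) x → (∀ y, Y y ∈ S y) →
    ∀ u, D Y x u ∈ S x

/-- The vector field `Y` along the curve `c`, read in the trivialization of the tangent bundle
that is centered at `c t`. -/
def alongCoord (c : ℝ → M) (Y : Π s : ℝ, TangentSpace 𝓘(ℝ, E) (c s)) (t s : ℝ) : E :=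
  (trivializationAt E (fun x : M => TangentSpace 𝓘(ℝ, E) x) (c t) ⟨c s, Y s⟩).2

/-- The covariant derivative at time `t` of a vector field `Y` along a curve `c` defined on `I`.
If `Y = ∑ y_i e_i` in the frame `e_i` given by the trivialization of the tangent bundle centered
at `c t`, this is `∑ y_i'(t) e_i + y_i(t) ∇_{c'(t)} e_i`; the vector field
`extend E (Y t) = ∑ y_i(t) e_i` has constant coefficients in that frame. -/
def covDerivAlong
    (D : (Π y : M, TangentSpace 𝓘(ℝ, E) y) → EndField E M) (c : ℝ → M) (I : Set ℝ)
    (Y : Π s : ℝ, TangentSpace 𝓘(ℝ, E) (c s)) (t : ℝ) : TangentSpace 𝓘(ℝ, E) (c t) :=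
  (trivializationAt E (fun x : M => TangentSpace 𝓘(ℝ, E) x) (c t)).symm (c t)
      (derivWithin (alongCoord c Y t) I t)
    + D (extend E (Y t)) (c t) (mfderivWithin 𝓘(ℝ, ℝ) 𝓘(ℝ, E) c I t (1 : ℝ))

/-- `Y` is a parallel vector field along the curve `c` defined on `I`. -/
def IsParallelAlong
    (D : (Π y : M, TangentSpace 𝓘(ℝ, E) y) → EndField E M) (c : ℝ → M) (I : Set ℝ)
    (Y : Π s : ℝ, TangentSpace 𝓘(ℝ, E) (c s)) : Prop :=
  ∀ t ∈ I, DifferentiableWithinAt ℝ (alongCoord c Y t) I t ∧ covDerivAlong D c I Y t = 0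

/-- `IsParallelTransport D x y τ`: the linear map `τ : T_x M → T_y M` is the parallel transport of
`D` along some piecewise `C¹` curve from `x` to `y`. -/
inductive IsParallelTransport
    (D : (Π y : M, TangentSpace 𝓘(ℝ, E) y) → EndField E M) :
    (x y : M) → (TangentSpace 𝓘(ℝ, E) x →ₗ[ℝ] TangentSpace 𝓘(ℝ, E) y) → Prop
  | curve (c : ℝ → M) (a b : ℝ) (hab : a < b)
      (hc : ContMDiffOn 𝓘(ℝ, ℝ) 𝓘(ℝ, E) 1 c (Set.Icc a b))
      (τ : TangentSpace 𝓘(ℝ, E) (c a) →ₗ[ℝ] TangentSpace 𝓘(ℝ, E) (c b))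
      (hτ : ∀ v, ∃ Y : Π s : ℝ, TangentSpace 𝓘(ℝ, E) (c s),
        IsParallelAlong D c (Set.Icc a b) Y ∧ Y a = v ∧ Y b = τ v) :
      IsParallelTransport D (c a) (c b) τ
  | trans (x y z : M) (σ : TangentSpace 𝓘(ℝ, E) x →ₗ[ℝ] TangentSpace 𝓘(ℝ, E) y)
      (τ : TangentSpace 𝓘(ℝ, E) y →ₗ[ℝ] TangentSpace 𝓘(ℝ, E) z)
      (hσ : IsParallelTransport D x y σ) (hτ : IsParallelTransport D y z τ) :
      IsParallelTransport D x z (τ.comp σ)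

/-- The holonomy group of `D` at `x`: the group of parallel transports along piecewise `C¹` loops
based at `x`. -/
def holonomyGroup (D : (Π y : M, TangentSpace 𝓘(ℝ, E) y) → EndField E M) (x : M) :
    Subgroup (TangentSpace 𝓘(ℝ, E) x ≃ₗ[ℝ] TangentSpace 𝓘(ℝ, E) x) :=
  Subgroup.closure {τ | IsParallelTransport D x x τ.toLinearMap}

/-- The holonomy representation of `D` at every point has a proper nonzero invariant subspace. -/
def HasReducibleHolonomy (D : (Π y : M, TangentSpace 𝓘(ℝ, E) y) → EndField E M) : Prop :=
  ∀ x : M, ∃ W : Submodule ℝ (TangentSpace 𝓘(ℝ, E) x), W ≠ ⊥ ∧ W ≠ ⊤ ∧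
    ∀ τ ∈ holonomyGroup D x, ∀ w ∈ W, τ w ∈ W

/-! ### Riemannian submersions -/

/-- The vertical space at `x`: the kernel of `dp_x`, tangent to the fiber of `p` through `x`. -/
def verticalSpace (E EN : Type*) [NormedAddCommGroup E] [NormedSpace ℝ E]
    [NormedAddCommGroup EN] [NormedSpace ℝ EN] {M N : Type*} [TopologicalSpace M]
    [ChartedSpace E M] [TopologicalSpace N] [ChartedSpace EN N] (p : M → N) (x : M) : Submodule ℝ (TangentSpace 𝓘(ℝ, E) x) :=
  (mfderiv 𝓘(ℝ, E) 𝓘(ℝ, EN) p x).ker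

variable (EN) in
/-- The horizontal space at `x`: the `g`-orthogonal complement of the vertical space. -/
def horizontalSpace (g : RiemMetric E M) (p : M → N) (x : M) :
    Submodule ℝ (TangentSpace 𝓘(ℝ, E) x) where
  carrier := {v | ∀ u ∈ verticalSpace E EN p x, g.inner x u v = 0}
  add_mem' ha hb u hu := by rw [map_add, ha u hu, hb u hu, add_zero]
  zero_mem' u _ := map_zero _
  smul_mem' c a ha u hu := by rw [map_smul, ha u hu, smul_zero]

variable (EN) in
theorem isCompl_vertical_horizontal (g : RiemMetric E M) (p : M → N) (x : M) :
    IsCompl (verticalSpace E EN p x) (horizontalSpace EN g p x) := by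
  have : FiniteDimensional ℝ (TangentSpace 𝓘(ℝ, E) x) := inferInstanceAs (FiniteDimensional ℝ E)
  let B : LinearMap.BilinForm ℝ (TangentSpace 𝓘(ℝ, E) x) :=
    (ContinuousLinearMap.coeLM ℝ).comp (g.inner x).toLinearMap
  have hs : ∀ u v, B u v = g.inner x u v := fun _ _ => rfl
  have hB : B.IsSymm := ⟨fun u v => g.symm x u v⟩
  have key : IsCompl (verticalSpace E EN p x)
      (B.orthogonal (verticalSpace E EN p x)) := by
    apply LinearMap.BilinForm.isCompl_orthogonal_of_restrict_nondegenerate hB.isRefl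
    refine ⟨fun u hu => ?_, fun u hu => ?_⟩ <;>
    · by_contra h
      exact (g.pos x u (by simpa using h)).ne' (hu u)
  exact key

/-- `p : (M, g) → (N, gN)` is a Riemannian submersion: a smooth submersion whose differential
is isometric on horizontal vectors. -/
structure IsRiemannianSubmersion (g : RiemMetric E M) (gN : RiemMetric EN N) (p : M → N) : Prop where
  smooth : ContMDiff 𝓘(ℝ, E) 𝓘(ℝ, EN) ∞ p
  surjective_mfderiv : ∀ x, Function.Surjective (mfderiv 𝓘(ℝ, E) 𝓘(ℝ, EN) p x)
  isometry : ∀ x, ∀ u ∈ horizontalSpace EN g p x, ∀ v ∈ horizontalSpace EN g p x,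
    gN.inner (p x) (mfderiv 𝓘(ℝ, E) 𝓘(ℝ, EN) p x u) (mfderiv 𝓘(ℝ, E) 𝓘(ℝ, EN) p x v)
      = g.inner x u v

variable (EN) in
/-- The orthogonal projection of `T_x M` onto the vertical space. -/
def verticalProj (g : RiemMetric E M) (p : M → N) (x : M) :
    TangentSpace 𝓘(ℝ, E) x →L[ℝ] TangentSpace 𝓘(ℝ, E) x :=
  have : FiniteDimensional ℝ (TangentSpace 𝓘(ℝ, E) x) := inferInstanceAs (FiniteDimensional ℝ E)
  have : T2Space (TangentSpace 𝓘(ℝ, E) x) := inferInstanceAs (T2Space E)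
  LinearMap.toContinuousLinearMap
    (Submodule.projection _ _ (isCompl_vertical_horizontal EN g p x))

variable (EN) in
/-- The orthogonal projection of `T_x M` onto the horizontal space. -/
def horizontalProj (g : RiemMetric E M) (p : M → N) (x : M) :
    TangentSpace 𝓘(ℝ, E) x →L[ℝ] TangentSpace 𝓘(ℝ, E) x :=
  ContinuousLinearMap.id ℝ _ - verticalProj EN g p x

variable (EN) in
theorem verticalProj_mem (g : RiemMetric E M) (p : M → N) (x : M) (u : TangentSpace 𝓘(ℝ, E) x) :
    verticalProj EN g p x u ∈ verticalSpace E EN p x :=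
  Submodule.projection_apply_mem _ u

variable (EN) in
theorem horizontalProj_mem (g : RiemMetric E M) (p : M → N) (x : M) (u : TangentSpace 𝓘(ℝ, E) x) :
    horizontalProj EN g p x u ∈ horizontalSpace EN g p x := by
  have h : verticalProj EN g p x (horizontalProj EN g p x u) = 0 := by
    have := Submodule.projection_apply_of_mem_left
      (isCompl_vertical_horizontal EN g p x) (verticalProj_mem EN g p x u)
    have h2 : verticalProj EN g p x (verticalProj EN g p x u)
      = verticalProj EN g p x u := this
    simp [horizontalProj, h2]
  exact (Submodule.projection_apply_eq_zero_iff _).1 h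

variable (EN) in
theorem proj_add (g : RiemMetric E M) (p : M → N) (x : M) (u : TangentSpace 𝓘(ℝ, E) x) :
    verticalProj EN g p x u + horizontalProj EN g p x u = u := by
  simp [horizontalProj]

variable (EN) in
/-- The bilinear form which is `g / 2` on vertical vectors, `g` on horizontal vectors, and
zero on a vertical and a horizontal vector. -/
def squashedInner (g : RiemMetric E M) (p : M → N) (x : M) :
    TangentSpace 𝓘(ℝ, E) x →L[ℝ] TangentSpace 𝓘(ℝ, E) x →L[ℝ] ℝ :=
  have : FiniteDimensional ℝ (TangentSpace 𝓘(ℝ, E) x) := inferInstanceAs (FiniteDimensional ℝ E)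
  have : T2Space (TangentSpace 𝓘(ℝ, E) x) := inferInstanceAs (T2Space E)
  (LinearMap.mk₂ ℝ (fun u v : TangentSpace 𝓘(ℝ, E) x =>
      (1 / 2) * g.inner x (verticalProj EN g p x u) (verticalProj EN g p x v)
        + g.inner x (horizontalProj EN g p x u) (horizontalProj EN g p x v))
    (fun _ _ _ => by simp only [map_add, add_apply]; ring)
    (fun _ _ _ => by simp only [map_smul, smul_apply, smul_eq_mul]; ring)
    (fun _ _ _ => by simp only [map_add]; ring)
    (fun _ _ _ => by simp only [map_smul, smul_eq_mul]; ring)).toContinuousBilinearMap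

variable (EN) in
theorem squashedInner_apply (g : RiemMetric E M) (p : M → N) (x : M)
    (u v : TangentSpace 𝓘(ℝ, E) x) : squashedInner EN g p x u v =
    (1 / 2) * g.inner x (verticalProj EN g p x u) (verticalProj EN g p x v)
    + g.inner x (horizontalProj EN g p x u) (horizontalProj EN g p x v) := rfl

variable (EN) in
theorem inner_eq_proj (g : RiemMetric E M) (p : M → N) (x : M)
    (u v : TangentSpace 𝓘(ℝ, E) x) : g.inner x u v =
    g.inner x (verticalProj EN g p x u) (verticalProj EN g p x v)
    + g.inner x (horizontalProj EN g p x u) (horizontalProj EN g p x v) := by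
  conv_lhs => rw [← proj_add EN g p x u, ← proj_add EN g p x v]
  have h1 := horizontalProj_mem EN g p x v _ (verticalProj_mem EN g p x u)
  have h2 := horizontalProj_mem EN g p x u _ (verticalProj_mem EN g p x v)
  rw [g.symm] at h2
  simp only [map_add, add_apply, h1, h2]
  ring

variable (EN) in
theorem half_inner_le_squashedInner (g : RiemMetric E M) (p : M → N) (x : M)
    (u : TangentSpace 𝓘(ℝ, E) x) : (1 / 2) * g.inner x u u ≤ squashedInner EN g p x u u := by
  have h : 0 ≤ g.inner x (horizontalProj EN g p x u) (horizontalProj EN g p x u) := by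
    by_cases h0 : horizontalProj EN g p x u = 0
    · simp [h0]
    · exact (g.pos x _ h0).le
  rw [squashedInner_apply, inner_eq_proj EN g p x u u]
  linarith

theorem squashedInner_eq {g : RiemMetric E M} {gN : RiemMetric EN N} {p : M → N}
    (hp : IsRiemannianSubmersion g gN p) (x : M) (u v : TangentSpace 𝓘(ℝ, E) x) :
    squashedInner EN g p x u v = (1 / 2) * g.inner x u v + (1 / 2) *
      gN.inner (p x) (mfderiv 𝓘(ℝ, E) 𝓘(ℝ, EN) p x u) (mfderiv 𝓘(ℝ, E) 𝓘(ℝ, EN) p x v) := by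
  have h : ∀ u, mfderiv 𝓘(ℝ, E) 𝓘(ℝ, EN) p x u
      = mfderiv 𝓘(ℝ, E) 𝓘(ℝ, EN) p x (horizontalProj EN g p x u) := fun u => by
    have h0 : mfderiv 𝓘(ℝ, E) 𝓘(ℝ, EN) p x (verticalProj EN g p x u) = 0 :=
      verticalProj_mem EN g p x u
    conv_lhs => rw [← proj_add EN g p x u, map_add, h0, zero_add]
  rw [h u, h v, hp.isometry x _ (horizontalProj_mem EN g p x u) _ (horizontalProj_mem EN g p x v),
    squashedInner_apply, inner_eq_proj EN g p x u v]
  ring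

theorem contMDiffAt_clm_of_apply {G : Type*} [NormedAddCommGroup G] [NormedSpace ℝ G]
    {f : M → E →L[ℝ] G} {x : M}
    (h : ∀ v, ContMDiffAt 𝓘(ℝ, E) 𝓘(ℝ, G) ∞ (fun m => f m v) x) :
    ContMDiffAt 𝓘(ℝ, E) 𝓘(ℝ, E →L[ℝ] G) ∞ f x := by
  let b := Module.finBasis ℝ E
  have e : f = fun m => ∑ i, ContinuousLinearMap.smulRightL ℝ E G
      (LinearMap.toContinuousLinearMap (b.coord i)) (f m (b i)) := by
    funext m
    ext v
    conv_lhs => rw [← b.sum_repr v, map_sum]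
    simp
  rw [e]
  refine ContMDiffAt.sum fun i _ => ?_
  exact (ContinuousLinearMap.contMDiff _).contMDiffAt.comp x (h (b i))

theorem contMDiff_squashedInner {g : RiemMetric E M} {gN : RiemMetric EN N} {p : M → N}
    (hp : IsRiemannianSubmersion g gN p) :
    ContMDiff 𝓘(ℝ, E) (𝓘(ℝ, E).prod 𝓘(ℝ, E →L[ℝ] E →L[ℝ] ℝ)) ∞
      (fun x => TotalSpace.mk' (E →L[ℝ] E →L[ℝ] ℝ)
        (E := fun x : M => TangentSpace 𝓘(ℝ, E) x →L[ℝ] TangentSpace 𝓘(ℝ, E) x →L[ℝ] ℝ)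
        x (squashedInner EN g p x)) := by
  intro x₀
  rw [contMDiffAt_hom_bundle]
  refine ⟨contMDiffAt_id, ?_⟩
  refine contMDiffAt_clm_of_apply fun v => contMDiffAt_clm_of_apply fun w => ?_
  let e := trivializationAt E (fun x : M => TangentSpace 𝓘(ℝ, E) x) x₀
  have he : x₀ ∈ e.baseSet := mem_baseSet_trivializationAt' x₀
  have hev : ∀ v : E, ContMDiffAt 𝓘(ℝ, E) (𝓘(ℝ, E).prod 𝓘(ℝ, E)) ∞
      (fun m => TotalSpace.mk' E (E := fun x : M => TangentSpace 𝓘(ℝ, E) x) m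
        (e.symm m v)) x₀ := by
    intro v
    rw [Trivialization.contMDiffAt_section_iff (IB := 𝓘(ℝ, E)) e he]
    refine (contMDiffAt_const (c := v)).congr_of_eventuallyEq ?_
    filter_upwards [e.open_baseSet.mem_nhds he] with m hm
    rw [e.mk_symm hm, e.apply_symm_apply (e.mem_target.2 hm)]
  have h1 : ContMDiffAt 𝓘(ℝ, E) 𝓘(ℝ, ℝ) ∞
      (fun m => squashedInner EN g p m (e.symm m v) (e.symm m w)) x₀ := by
    have hT : ∀ v : E, ContMDiffAt 𝓘(ℝ, E) (𝓘(ℝ, EN).prod 𝓘(ℝ, EN)) ∞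
        (fun m => TotalSpace.mk' EN (E := fun x : N => TangentSpace 𝓘(ℝ, EN) x) (p m)
          (mfderiv 𝓘(ℝ, E) 𝓘(ℝ, EN) p m (e.symm m v))) x₀ := fun v =>
      ((hp.smooth.contMDiff_tangentMap (m := ∞) (by simp)).contMDiffAt).comp x₀ (hev v)
    simp only [squashedInner_eq hp]
    refine ContMDiffAt.add (contMDiffAt_const.mul ?_) (contMDiffAt_const.mul ?_)
    · let _ : RiemannianBundle (fun x : M => TangentSpace 𝓘(ℝ, E) x) := ⟨g.toRiemannianMetric⟩
      exact ContMDiffAt.inner_bundle (F := E) (E := fun x : M => TangentSpace 𝓘(ℝ, E) x)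
        (hev v) (hev w)
    · let _ : RiemannianBundle (fun x : N => TangentSpace 𝓘(ℝ, EN) x) := ⟨gN.toRiemannianMetric⟩
      exact ContMDiffAt.inner_bundle (F := EN) (E := fun x : N => TangentSpace 𝓘(ℝ, EN) x)
        (hT v) (hT w)
  refine h1.congr_of_eventuallyEq ?_
  filter_upwards [e.open_baseSet.mem_nhds he] with m hm
  have hm' : m ∈ (trivializationAt (E →L[ℝ] ℝ)
      (fun b : M => TangentSpace 𝓘(ℝ, E) b →L[ℝ] ℝ) x₀).baseSet := by
    simpa [hom_trivializationAt_baseSet, e] using hm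
  rw [ContinuousLinearMap.inCoordinates_eq hm hm']
  simp [hom_trivializationAt_apply, ContinuousLinearMap.inCoordinates, e]
  exact congrArg _ (Trivialization.symmL_apply _ hm w)

/-- The Riemannian metric which is `g / 2` on vertical vectors and `g` on horizontal vectors,
with vertical and horizontal vectors orthogonal. -/
def squashedMetric (g : RiemMetric E M) (gN : RiemMetric EN N) (p : M → N)
    (hp : IsRiemannianSubmersion g gN p) : RiemMetric E M where
  inner := squashedInner EN g p
  symm x u v := by
    simp only [squashedInner_apply, g.symm x (verticalProj EN g p x u),
      g.symm x (horizontalProj EN g p x u)]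
  pos x u hu := by
    have h1 := half_inner_le_squashedInner EN g p x u
    have h2 := g.pos x u hu
    linarith
  isVonNBounded x := by
    have h : Bornology.IsVonNBounded ℝ ((fun v : TangentSpace 𝓘(ℝ, E) x => (2 : ℝ) • v) ''
        {v : TangentSpace 𝓘(ℝ, E) x | g.inner x v v < 1}) :=
      (g.isVonNBounded x).image ((2 : ℝ) • ContinuousLinearMap.id ℝ (TangentSpace 𝓘(ℝ, E) x))
    refine Bornology.IsVonNBounded.subset ?_ h
    intro v hv
    refine ⟨(1 / 2 : ℝ) • v, ?_, by simp [smul_smul]⟩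
    have h1 := half_inner_le_squashedInner EN g p x v
    have hv' : squashedInner EN g p x v v < 1 := hv
    simp only [Set.mem_ofPred_eq, map_smul, smul_apply, smul_eq_mul]
    linarith
  contMDiff := contMDiff_squashedInner hp

/-- The fibers of `p` are totally geodesic: their second fundamental form, the horizontal part of
`∇_u W` for vertical `u` and `W`, vanishes. -/
def HasTotallyGeodesicFibers (EN : Type*) [NormedAddCommGroup EN] [NormedSpace ℝ EN]
    [ChartedSpace EN N] (g : RiemMetric E M) (p : M → N) : Prop :=
  ∀ (x : M) (W : Π y : M, TangentSpace 𝓘(ℝ, E) y), MDiffAt (T% W) x →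
    (∀ y, W y ∈ verticalSpace E EN p y) →
    ∀ u ∈ verticalSpace E EN p x, leviCivita g W x u ∈ verticalSpace E EN p x

/-- The almost complex structure which is `-J` on vertical vectors and `J` on horizontal
vectors. -/
def reversedJ (EN : Type*) [NormedAddCommGroup EN] [NormedSpace ℝ EN] [FiniteDimensional ℝ EN]
    [ChartedSpace EN N] [IsManifold 𝓘(ℝ, EN) ∞ N] (g : RiemMetric E M) (p : M → N)
    (J : EndField E M) : EndField E M :=
  fun x => (J x).comp (horizontalProj EN g p x) - (J x).comp (verticalProj EN g p x)

end

/-!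
Let `P` be the orthogonal projection onto the fibers. Everything is governed by the tensor `∇P`:
O'Neill's formula `g(∇_u W, u) = 0` (`W` vertical, `u` horizontal) and the fibers being totally
geodesic say that `(∇_u P) v` vanishes for vertical `u` and is alternating on horizontal vectors,
while `∇J = 0` makes it commute with `J`. The Levi-Civita connection of the squashed metric differs
from `∇` by `-½ ((∇_u P) P v + (∇_v P) P u)`, which turns nearly Kähler into an algebraic identity
and identifies the canonical Hermitian connection with the Schouten–van Kampen connection
`P ∇ P + (1 - P) ∇ (1 - P)`. For the latter `P` is parallel, hence so are the forms `g(P ·, ·)` and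
`g((1 - P) ·, ·)`, whose null spaces are the two distributions; holonomy preserves them.
-/

noncomputable section

section Coordinates

variable {E : Type*} [NormedAddCommGroup E] [NormedSpace ℝ E]
  {M : Type*} [TopologicalSpace M] [ChartedSpace E M]

/-- A field of bilinear forms on the tangent spaces of `M`. -/
abbrev BilinField (E : Type*) [NormedAddCommGroup E] [NormedSpace ℝ E]
    (M : Type*) [TopologicalSpace M] [ChartedSpace E M] :=
  Π x : M, TangentSpace 𝓘(ℝ, E) x →L[ℝ] TangentSpace 𝓘(ℝ, E) x →L[ℝ] ℝ

variable [IsManifold 𝓘(ℝ, E) ∞ M]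

/-- Smoothness of a field of endomorphisms at a point. -/
def SmoothEndAt (A : EndField E M) (x : M) : Prop :=
  ContMDiffAt 𝓘(ℝ, E) (𝓘(ℝ, E).prod 𝓘(ℝ, E →L[ℝ] E)) ∞
    (fun x => TotalSpace.mk' (E →L[ℝ] E)
      (E := fun x : M => TangentSpace 𝓘(ℝ, E) x →L[ℝ] TangentSpace 𝓘(ℝ, E) x) x (A x)) x

/-- Smoothness of a field of bilinear forms at a point. -/
def SmoothBilinAt (B : BilinField E M) (x : M) : Prop :=
  ContMDiffAt 𝓘(ℝ, E) (𝓘(ℝ, E).prod 𝓘(ℝ, E →L[ℝ] E →L[ℝ] ℝ)) ∞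
    (fun x => TotalSpace.mk' (E →L[ℝ] E →L[ℝ] ℝ)
      (E := fun x : M => TangentSpace 𝓘(ℝ, E) x →L[ℝ] TangentSpace 𝓘(ℝ, E) x →L[ℝ] ℝ) x (B x)) x

/-- The trivialization of the tangent bundle of `M` centered at `x₀`. -/
abbrev tangentTriv (E : Type*) [NormedAddCommGroup E] [NormedSpace ℝ E]
    {M : Type*} [TopologicalSpace M] [ChartedSpace E M] [IsManifold 𝓘(ℝ, E) ∞ M] (x₀ : M) :
    Trivialization E (TotalSpace.proj : TotalSpace E (TangentSpace 𝓘(ℝ, E) (M := M)) → M) :=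
  trivializationAt E (fun x : M => TangentSpace 𝓘(ℝ, E) x) x₀

variable (E) in
theorem tangentTriv_baseSet_mem_nhds (x : M) : (tangentTriv E x).baseSet ∈ nhds x :=
  (tangentTriv E x).open_baseSet.mem_nhds (mem_baseSet_trivializationAt' x)

/-- The bilinear form `B m` in the trivialization of the tangent bundle centered at `x₀`. -/
def bilinCoord (B : BilinField E M) (x₀ m : M) : E →L[ℝ] E →L[ℝ] ℝ :=
  ContinuousLinearMap.inCoordinates E (fun x : M => TangentSpace 𝓘(ℝ, E) x) (E →L[ℝ] ℝ)
    (fun x : M => TangentSpace 𝓘(ℝ, E) x →L[ℝ] ℝ) x₀ m x₀ m (B m)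

/-- The endomorphism `A m` in the trivialization of the tangent bundle centered at `x₀`. -/
def endCoord (A : EndField E M) (x₀ m : M) : E →L[ℝ] E :=
  ContinuousLinearMap.inCoordinates E (fun x : M => TangentSpace 𝓘(ℝ, E) x) E
    (fun x : M => TangentSpace 𝓘(ℝ, E) x) x₀ m x₀ m (A m)

theorem smoothBilinAt_iff {B : BilinField E M} {x : M} :
    SmoothBilinAt B x ↔ ContMDiffAt 𝓘(ℝ, E) 𝓘(ℝ, E →L[ℝ] E →L[ℝ] ℝ) ∞ (bilinCoord B x) x := by
  rw [SmoothBilinAt, contMDiffAt_hom_bundle]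
  exact and_iff_right contMDiffAt_id

theorem smoothEndAt_iff {A : EndField E M} {x : M} :
    SmoothEndAt A x ↔ ContMDiffAt 𝓘(ℝ, E) 𝓘(ℝ, E →L[ℝ] E) ∞ (endCoord A x) x := by
  rw [SmoothEndAt, contMDiffAt_hom_bundle]
  exact and_iff_right contMDiffAt_id

theorem bilinCoord_apply (B : BilinField E M) {x₀ m : M} (hm : m ∈ (tangentTriv E x₀).baseSet)
    (v w : E) :
    bilinCoord B x₀ m v w = B m ((tangentTriv E x₀).symm m v) ((tangentTriv E x₀).symm m w) := by
  have hm' : m ∈ (trivializationAt (E →L[ℝ] ℝ)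
      (fun b : M => TangentSpace 𝓘(ℝ, E) b →L[ℝ] ℝ) x₀).baseSet := by
    simpa only [hom_trivializationAt_baseSet, Trivial.fiberBundle_trivializationAt',
      Trivial.trivialization_baseSet, Set.inter_univ] using hm
  rw [bilinCoord, ContinuousLinearMap.inCoordinates_eq hm hm']
  simp only [ContinuousLinearMap.comp_apply, ContinuousLinearEquiv.coe_coe,
    Trivialization.continuousLinearEquivAt_symm_apply,
    Trivialization.continuousLinearEquivAt_apply, hom_trivializationAt_apply,
    ContinuousLinearMap.inCoordinates, Trivial.fiberBundle_trivializationAt',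
    Trivial.continuousLinearMapAt_trivialization, ContinuousLinearMap.id_comp]
  exact congrArg _ (Trivialization.symmL_apply _ hm w)

theorem endCoord_apply (A : EndField E M) {x₀ m : M} (hm : m ∈ (tangentTriv E x₀).baseSet)
    (v : E) :
    endCoord A x₀ m v = (tangentTriv E x₀ ⟨m, A m ((tangentTriv E x₀).symm m v)⟩).2 := by
  rw [endCoord, ContinuousLinearMap.inCoordinates_eq hm hm]
  simp

theorem symm_endCoord_apply (A : EndField E M) {x₀ m : M} (hm : m ∈ (tangentTriv E x₀).baseSet)
    (v : E) :
    (tangentTriv E x₀).symm m (endCoord A x₀ m v) = A m ((tangentTriv E x₀).symm m v) := by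
  rw [endCoord_apply A hm]
  exact Trivialization.symm_apply_apply_mk _ hm _

theorem SmoothEndAt.comp {A B : EndField E M} {x : M} (hA : SmoothEndAt A x)
    (hB : SmoothEndAt B x) : SmoothEndAt (fun y => (A y).comp (B y)) x := by
  rw [smoothEndAt_iff] at *
  refine (hA.clm_comp hB).congr_of_eventuallyEq ?_
  filter_upwards [tangentTriv_baseSet_mem_nhds E x] with m hm
  ext v
  rw [ContinuousLinearMap.comp_apply, endCoord_apply _ hm, endCoord_apply A hm,
    symm_endCoord_apply B hm, ContinuousLinearMap.comp_apply]

theorem SmoothEndAt.sub {A B : EndField E M} {x : M} (hA : SmoothEndAt A x)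
    (hB : SmoothEndAt B x) : SmoothEndAt (fun y => A y - B y) x :=
  ContMDiffAt.sub_section (V := fun x : M => TangentSpace 𝓘(ℝ, E) x →L[ℝ] TangentSpace 𝓘(ℝ, E) x)
    hA hB

theorem SmoothEndAt.const_smul {A : EndField E M} {x : M} (hA : SmoothEndAt A x) (c : ℝ) :
    SmoothEndAt (fun y => c • A y) x :=
  ContMDiffAt.const_smul_section
    (V := fun x : M => TangentSpace 𝓘(ℝ, E) x →L[ℝ] TangentSpace 𝓘(ℝ, E) x) hA

theorem smoothEndAt_id (x : M) :
    SmoothEndAt (fun y => ContinuousLinearMap.id ℝ (TangentSpace 𝓘(ℝ, E) y)) x := by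
  rw [smoothEndAt_iff]
  refine (contMDiffAt_const (c := ContinuousLinearMap.id ℝ E)).congr_of_eventuallyEq ?_
  filter_upwards [tangentTriv_baseSet_mem_nhds E x] with m hm
  ext v
  rw [endCoord_apply _ hm]
  exact congrArg Prod.snd (Trivialization.apply_mk_symm _ hm v)

theorem SmoothEndAt.mdiffAt_apply {A : EndField E M} {x : M} (hA : SmoothEndAt A x)
    {Y : Π y : M, TangentSpace 𝓘(ℝ, E) y} (hY : MDiffAt (T% Y) x) :
    MDiffAt (T% (fun y => A y (Y y))) x :=
  MDifferentiableAt.clm_bundle_apply (b := fun y => y) (hA.mdifferentiableAt (by simp)) hY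

theorem SmoothBilinAt.comp {A : EndField E M} {B : BilinField E M} {x : M}
    (hB : SmoothBilinAt B x) (hA : SmoothEndAt A x) :
    SmoothBilinAt (fun y => (B y).comp (A y)) x := by
  rw [smoothBilinAt_iff] at *
  rw [smoothEndAt_iff] at hA
  refine (hB.clm_comp hA).congr_of_eventuallyEq ?_
  filter_upwards [tangentTriv_baseSet_mem_nhds E x] with m hm
  ext v w
  rw [ContinuousLinearMap.comp_apply, bilinCoord_apply _ hm, bilinCoord_apply B hm,
    symm_endCoord_apply A hm, ContinuousLinearMap.comp_apply]

end Coordinates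

section MetricCoordinates

variable {E : Type*} [NormedAddCommGroup E] [NormedSpace ℝ E]
  {M : Type*} [TopologicalSpace M] [ChartedSpace E M] [IsManifold 𝓘(ℝ, E) ∞ M]

theorem RiemMetric.smoothBilinAt (g : RiemMetric E M) (x : M) :
    SmoothBilinAt (fun y => g.inner y) x := g.contMDiff x

theorem bilinCoord_injective (g : RiemMetric E M) {x₀ m : M}
    (hm : m ∈ (tangentTriv E x₀).baseSet) :
    Function.Injective (bilinCoord (fun y => g.inner y) x₀ m) := by
  rw [injective_iff_map_eq_zero]
  intro v hv
  have hsymm : (tangentTriv E x₀).symm m v = 0 := by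
    by_contra hne
    refine (g.pos m _ hne).ne' ?_
    rw [← bilinCoord_apply (fun y => g.inner y) hm, hv, zero_apply]
  have hv' := congrArg Prod.snd ((tangentTriv E x₀).apply_mk_symm hm v)
  rw [hsymm] at hv'
  refine hv'.symm.trans ?_
  exact ((tangentTriv E x₀).continuousLinearMapAt_apply_of_mem (R := ℝ) hm 0).symm.trans
    (map_zero _)

variable [FiniteDimensional ℝ E]

theorem bilinCoord_isInvertible (g : RiemMetric E M) {x₀ m : M}
    (hm : m ∈ (tangentTriv E x₀).baseSet) :
    (bilinCoord (fun y => g.inner y) x₀ m).IsInvertible := by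
  have hdim : Module.finrank ℝ E = Module.finrank ℝ (E →L[ℝ] ℝ) := by
    rw [← (LinearMap.toContinuousLinearMap (𝕜 := ℝ) (E := E) (F' := ℝ)).finrank_eq]
    exact Subspace.dual_finrank_eq.symm
  exact ⟨(LinearEquiv.ofInjectiveOfFinrankEq (bilinCoord (fun y => g.inner y) x₀ m).toLinearMap
    (bilinCoord_injective g hm) hdim).toContinuousLinearEquiv, rfl⟩

theorem smoothEndAt_of_inner (g : RiemMetric E M) {A : EndField E M} {B : BilinField E M} {x : M}
    (hB : SmoothBilinAt B x) (h : ∀ y u v, g.inner y (A y u) v = B y u v) : SmoothEndAt A x := by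
  rw [smoothEndAt_iff]
  rw [smoothBilinAt_iff] at hB
  obtain ⟨L, hL⟩ := bilinCoord_isInvertible g
    (mem_of_mem_nhds (tangentTriv_baseSet_mem_nhds E x))
  have hinv : ContMDiffAt 𝓘(ℝ, E) 𝓘(ℝ, (E →L[ℝ] ℝ) →L[ℝ] E) ∞
      (fun m => (bilinCoord (fun y => g.inner y) x m).inverse) x := by
    refine ContMDiffAt.comp x (g := ContinuousLinearMap.inverse) ?_
      (smoothBilinAt_iff.1 (g.smoothBilinAt x))
    rw [← hL]
    exact (contDiffAt_map_inverse L).contMDiffAt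
  refine (hinv.clm_comp hB).congr_of_eventuallyEq ?_
  filter_upwards [tangentTriv_baseSet_mem_nhds E x] with m hm
  have hcoord : (bilinCoord (fun y => g.inner y) x m).comp (endCoord A x m) =
      bilinCoord B x m := by
    ext v w
    rw [ContinuousLinearMap.comp_apply, bilinCoord_apply _ hm, symm_endCoord_apply A hm, h,
      bilinCoord_apply _ hm]
  rw [← hcoord, ← ContinuousLinearMap.comp_assoc, (bilinCoord_isInvertible g hm).inverse_comp_self]
  rfl

end MetricCoordinates

section AlongMaps

variable {F G K : Type*} [NormedAddCommGroup F] [NormedSpace ℝ F] [NormedAddCommGroup G]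
  [NormedSpace ℝ G] [NormedAddCommGroup K] [NormedSpace ℝ K]
  {X : Type*} [TopologicalSpace X] [ChartedSpace F X] {s : Set X} {x : X}

theorem hasMFDerivWithinAt_clm_apply {c : X → G →L[ℝ] K} {u : X → G}
    {c' : F →L[ℝ] G →L[ℝ] K} {u' : F →L[ℝ] G}
    (hc : HasMFDerivWithinAt 𝓘(ℝ, F) 𝓘(ℝ, G →L[ℝ] K) c s x c')
    (hu : HasMFDerivWithinAt 𝓘(ℝ, F) 𝓘(ℝ, G) u s x u') :
    HasMFDerivWithinAt 𝓘(ℝ, F) 𝓘(ℝ, K) (fun y => c y (u y)) s x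
      ((c x).comp u' + c'.flip (u x) : F →L[ℝ] K) := by
  refine ⟨hc.1.clm_apply hu.1, ?_⟩
  have hc' : HasFDerivWithinAt (fun z => c ((extChartAt 𝓘(ℝ, F) x).symm z)) c'
      ((extChartAt 𝓘(ℝ, F) x).symm ⁻¹' s ∩ Set.range 𝓘(ℝ, F)) (extChartAt 𝓘(ℝ, F) x x) := hc.2
  have hcu := hc'.clm_apply hu.2
  simp only [writtenInExtChartAt, extChartAt_model_space_eq_id, PartialEquiv.refl_coe,
    Function.comp_apply, id_eq, extChartAt_to_inv] at hcu
  exact hcu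

variable {E : Type*} [NormedAddCommGroup E] [NormedSpace ℝ E]
  {M : Type*} [TopologicalSpace M] [ChartedSpace E M] [IsManifold 𝓘(ℝ, E) ∞ M]

theorem eq_bilinCoord_tangentTriv (B : BilinField E M) {x₀ m : M}
    (hm : m ∈ (tangentTriv E x₀).baseSet) (v w : TangentSpace 𝓘(ℝ, E) m) :
    B m v w = bilinCoord B x₀ m (tangentTriv E x₀ ⟨m, v⟩).2 (tangentTriv E x₀ ⟨m, w⟩).2 := by
  rw [bilinCoord_apply B hm, (tangentTriv E x₀).symm_apply_apply_mk hm,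
    (tangentTriv E x₀).symm_apply_apply_mk hm]

theorem SmoothBilinAt.exists_hasMFDerivAt_bilinCoord {B : BilinField E M} {m : M}
    (hB : SmoothBilinAt B m) : ∃ C' : E →L[ℝ] E →L[ℝ] E →L[ℝ] ℝ,
      HasMFDerivAt 𝓘(ℝ, E) 𝓘(ℝ, E →L[ℝ] E →L[ℝ] ℝ) (bilinCoord B m) m C' :=
  ⟨_, ((smoothBilinAt_iff.1 hB).mdifferentiableAt (by simp)).hasMFDerivAt⟩

theorem mvfderiv_extend_of_hasMFDerivAt {B : BilinField E M} {m : M}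
    {C' : E →L[ℝ] E →L[ℝ] E →L[ℝ] ℝ}
    (hC : HasMFDerivAt 𝓘(ℝ, E) 𝓘(ℝ, E →L[ℝ] E →L[ℝ] ℝ) (bilinCoord B m) m C')
    (u v w : TangentSpace 𝓘(ℝ, E) m) :
    d% (fun q => B q (extend E v q) (extend E w q)) m u =
      C' u (tangentTriv E m ⟨m, v⟩).2 (tangentTriv E m ⟨m, w⟩).2 := by
  set a := (tangentTriv E m ⟨m, v⟩).2
  set b := (tangentTriv E m ⟨m, w⟩).2
  have hconst (e : E) : HasMFDerivWithinAt 𝓘(ℝ, E) 𝓘(ℝ, E) (fun _ : M => e) Set.univ m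
      (0 : E →L[ℝ] E) := hasMFDerivWithinAt_const e _ _
  have hcoord : HasMFDerivAt 𝓘(ℝ, E) 𝓘(ℝ, ℝ) (fun q => bilinCoord B m q a b) m _ :=
    hasMFDerivWithinAt_univ.1 (hasMFDerivWithinAt_clm_apply (hasMFDerivWithinAt_clm_apply
      (hasMFDerivWithinAt_univ.2 hC) (hconst a)) (hconst b))
  have hextend : (fun q => B q (extend E v q) (extend E w q)) =ᶠ[nhds m]
      fun q => bilinCoord B m q a b := by
    filter_upwards [tangentTriv_baseSet_mem_nhds E m] with q hq
    rw [bilinCoord_apply B hq]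
    rfl
  rw [mvfderiv, (hcoord.congr_of_eventuallyEq hextend).mfderiv]
  simp only [ContinuousLinearMap.comp_zero, zero_add]
  rfl

/-- The vectors `v y` and `w y` are vector fields along `b`, given by their coordinates in the
trivialization centered at `b x`; with `extend E (v x)`, the vector field of constant
coordinates, the right-hand side is a product rule. -/
theorem SmoothBilinAt.exists_hasMFDerivWithinAt_along {B : BilinField E M} {b : X → M}
    (hB : SmoothBilinAt B (b x)) {b' : F →L[ℝ] TangentSpace 𝓘(ℝ, E) (b x)}
    (hb : HasMFDerivWithinAt 𝓘(ℝ, F) 𝓘(ℝ, E) b s x b')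
    (v w : Π y : X, TangentSpace 𝓘(ℝ, E) (b y)) {v' w' : F →L[ℝ] E}
    (hv : HasMFDerivWithinAt 𝓘(ℝ, F) 𝓘(ℝ, E) (fun y => (tangentTriv E (b x) ⟨b y, v y⟩).2) s x v')
    (hw : HasMFDerivWithinAt 𝓘(ℝ, F) 𝓘(ℝ, E) (fun y => (tangentTriv E (b x) ⟨b y, w y⟩).2) s x w') :
    ∃ f' : F →L[ℝ] ℝ,
      HasMFDerivWithinAt 𝓘(ℝ, F) 𝓘(ℝ, ℝ) (fun y => B (b y) (v y) (w y)) (insert x s) x f' ∧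
      ∀ u, f' u = d% (fun q => B q (extend E (v x) q) (extend E (w x) q)) (b x) (b' u)
        + B (b x) ((tangentTriv E (b x)).symm (b x) (v' u)) (w x)
        + B (b x) (v x) ((tangentTriv E (b x)).symm (b x) (w' u)) := by
  have hbase := tangentTriv_baseSet_mem_nhds E (b x)
  have hx := mem_of_mem_nhds hbase
  obtain ⟨C', hC⟩ := hB.exists_hasMFDerivAt_bilinCoord
  have hCb : HasMFDerivWithinAt 𝓘(ℝ, F) 𝓘(ℝ, E →L[ℝ] E →L[ℝ] ℝ)
      (fun y => bilinCoord B (b x) (b y)) s x (C'.comp b' : F →L[ℝ] E →L[ℝ] E →L[ℝ] ℝ) :=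
    hC.comp_hasMFDerivWithinAt x hb
  have hcoord := hasMFDerivWithinAt_clm_apply (hasMFDerivWithinAt_clm_apply hCb hv) hw
  refine ⟨_, hcoord.insert.congr_of_eventuallyEq ?_ ?_, fun u => ?_⟩
  · filter_upwards [hb.insert.1 hbase] with y hy using eq_bilinCoord_tangentTriv B hy _ _
  · exact eq_bilinCoord_tangentTriv B hx _ _
  · have hsymm (a : E) : (tangentTriv E (b x) ⟨b x, (tangentTriv E (b x)).symm (b x) a⟩).2 = a :=
      congrArg Prod.snd ((tangentTriv E (b x)).apply_mk_symm hx a)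
    rw [mvfderiv_extend_of_hasMFDerivAt hC, eq_bilinCoord_tangentTriv B hx,
      eq_bilinCoord_tangentTriv B hx, hsymm, hsymm]
    change bilinCoord B (b x) (b x) (tangentTriv E (b x) ⟨b x, v x⟩).2 (w' u) +
      (bilinCoord B (b x) (b x) (v' u) (tangentTriv E (b x) ⟨b x, w x⟩).2 +
      C' (b' u) (tangentTriv E (b x) ⟨b x, v x⟩).2 (tangentTriv E (b x) ⟨b x, w x⟩).2) = _
    ring

end AlongMaps

section LieBracket

variable {E : Type*} [NormedAddCommGroup E] [NormedSpace ℝ E]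
  {M : Type*} [TopologicalSpace M] [ChartedSpace E M]

/-- The vector field `Z` read in the chart centered at `x`. -/
def chartField (Z : Π y : M, TangentSpace 𝓘(ℝ, E) y) (x : M) : E → E :=
  mpullbackWithin 𝓘(ℝ, E) 𝓘(ℝ, E) (extChartAt 𝓘(ℝ, E) x).symm Z (Set.range 𝓘(ℝ, E))

variable {x : M} {F : Type*} [NormedAddCommGroup F] [NormedSpace ℝ F] {f : M → F}

theorem contDiffAt_comp_extChartAt_symm (hf : ContMDiffAt 𝓘(ℝ, E) 𝓘(ℝ, F) ∞ f x) :
    ContDiffAt ℝ ∞ (fun z => f ((extChartAt 𝓘(ℝ, E) x).symm z)) (extChartAt 𝓘(ℝ, E) x x) := by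
  have h := (contMDiffAt_iff.1 hf).2
  rw [modelWithCornersSelf_coe, Set.range_id, contDiffWithinAt_univ] at h
  exact h

variable [IsManifold 𝓘(ℝ, E) ∞ M]

theorem chartField_apply (Z : Π y : M, TangentSpace 𝓘(ℝ, E) y) {y : M}
    (hy : y ∈ (extChartAt 𝓘(ℝ, E) x).source) :
    chartField Z x (extChartAt 𝓘(ℝ, E) x y) =
      mfderiv 𝓘(ℝ, E) 𝓘(ℝ, E) (extChartAt 𝓘(ℝ, E) x) y (Z y) := by
  have : IsManifold 𝓘(ℝ, E) 1 M := .of_le (n := ∞) (by simp)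
  have hZ : (Z ((extChartAt 𝓘(ℝ, E) x).symm (extChartAt 𝓘(ℝ, E) x y)) : E) = Z y :=
    congrArg (fun q => (Z q : E)) ((extChartAt 𝓘(ℝ, E) x).left_inv hy)
  rw [chartField, mpullbackWithin_apply]
  exact (isInvertible_mfderivWithin_extChartAt_symm
    ((extChartAt 𝓘(ℝ, E) x).map_source hy)).inverse_apply_eq.2 (hZ.trans
      congr($(mfderivWithin_extChartAt_symm_comp_mfderiv_extChartAt' (I := 𝓘(ℝ, E)) hy) (Z y)).symm)

theorem differentiableAt_chartField [CompleteSpace E] {Z : Π y : M, TangentSpace 𝓘(ℝ, E) y}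
    (hZ : MDiffAt (T% Z) x) :
    DifferentiableAt ℝ (chartField Z x) (extChartAt 𝓘(ℝ, E) x x) := by
  have : IsManifold 𝓘(ℝ, E) 2 M := .of_le (n := ∞) ENat.LEInfty.out
  have h := hZ.mdifferentiableWithinAt
    (s := Set.univ).differentiableWithinAt_mpullbackWithin_vectorField
  rw [Set.preimage_univ, Set.univ_inter, modelWithCornersSelf_coe, Set.range_id] at h
  rw [← differentiableWithinAt_univ]
  simpa only [chartField, modelWithCornersSelf_coe, Set.range_id] using h

theorem mfderiv_extChartAt_mlieBracket (X Y : Π y : M, TangentSpace 𝓘(ℝ, E) y) :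
    mfderiv 𝓘(ℝ, E) 𝓘(ℝ, E) (extChartAt 𝓘(ℝ, E) x) x (mlieBracket 𝓘(ℝ, E) X Y x) =
      lieBracket ℝ (chartField X x) (chartField Y x) (extChartAt 𝓘(ℝ, E) x x) := by
  have : IsManifold 𝓘(ℝ, E) 1 M := .of_le (n := ∞) (by simp)
  have hinv := isInvertible_mfderiv_extChartAt (I := 𝓘(ℝ, E)) (mem_extChartAt_source x)
  have huniv : lieBracket ℝ (chartField X x) (chartField Y x) (extChartAt 𝓘(ℝ, E) x x) =
      lieBracketWithin ℝ (chartField X x) (chartField Y x)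
        ((extChartAt 𝓘(ℝ, E) x).symm ⁻¹' Set.univ ∩ Set.range 𝓘(ℝ, E))
        (extChartAt 𝓘(ℝ, E) x x) := by simp
  rw [huniv]
  exact (hinv.inverse_apply_eq.1 rfl).symm

theorem eventually_mvfderiv_eq_fderiv_chart (hf : ContMDiffAt 𝓘(ℝ, E) 𝓘(ℝ, F) ∞ f x) :
    ∀ᶠ y in nhds x, ∀ u : TangentSpace 𝓘(ℝ, E) y,
      d% f y u = fderiv ℝ (fun z => f ((extChartAt 𝓘(ℝ, E) x).symm z)) (extChartAt 𝓘(ℝ, E) x y)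
        (mfderiv 𝓘(ℝ, E) 𝓘(ℝ, E) (extChartAt 𝓘(ℝ, E) x) y u) := by
  have : IsManifold 𝓘(ℝ, E) 1 M := .of_le (n := ∞) (by simp)
  have hG := (contDiffAt_comp_extChartAt_symm hf).of_le (m := 1) (by simp)
  filter_upwards [(continuousAt_extChartAt x).eventually (hG.eventually (by simp)),
    extChartAt_source_mem_nhds (I := 𝓘(ℝ, E)) x] with y hy hys u
  have hcomp := (hy.differentiableAt one_ne_zero).hasFDerivAt.hasMFDerivAt.comp y
    (mdifferentiableAt_extChartAt (I := 𝓘(ℝ, E)) (by simpa using hys)).hasMFDerivAt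
  have hderiv : HasMFDerivAt 𝓘(ℝ, E) 𝓘(ℝ, F) f y _ := hcomp.congr_of_eventuallyEq <| by
    filter_upwards [extChartAt_source_mem_nhds' hys] with q hq
    exact (congrArg f ((extChartAt 𝓘(ℝ, E) x).left_inv hq)).symm
  rw [mvfderiv, hderiv.mfderiv]
  rfl

theorem mvfderiv_mvfderiv_eq_fderiv_chart [CompleteSpace E]
    (hf : ContMDiffAt 𝓘(ℝ, E) 𝓘(ℝ, F) ∞ f x)
    {Z : Π y : M, TangentSpace 𝓘(ℝ, E) y} (hZ : MDiffAt (T% Z) x)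
    (W : Π y : M, TangentSpace 𝓘(ℝ, E) y) :
    let G : E → F := fun z => f ((extChartAt 𝓘(ℝ, E) x).symm z)
    let x' := extChartAt 𝓘(ℝ, E) x x
    d% (fun y => d% f y (Z y)) x (W x) =
      fderiv ℝ (fderiv ℝ G) x' (chartField W x x') (chartField Z x x') +
        fderiv ℝ G x' (fderiv ℝ (chartField Z x) x' (chartField W x x')) := by
  intro G x'
  have : IsManifold 𝓘(ℝ, E) 1 M := .of_le (n := ∞) (by simp)
  have hG' : DifferentiableAt ℝ (fderiv ℝ G) x' :=
    ((contDiffAt_comp_extChartAt_symm hf).fderiv_right (m := 1)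
      (by rw [one_add_one_eq_two]; exact ENat.LEInfty.out)).differentiableAt one_ne_zero
  have hcomp := (hG'.hasFDerivAt.clm_apply
    (differentiableAt_chartField hZ).hasFDerivAt).hasMFDerivAt.comp x
      (mdifferentiableAt_extChartAt (I := 𝓘(ℝ, E)) (mem_chart_source E x)).hasMFDerivAt
  have hderiv : HasMFDerivAt 𝓘(ℝ, E) 𝓘(ℝ, F) (fun y => d% f y (Z y)) x _ :=
    hcomp.congr_of_eventuallyEq <| by
      filter_upwards [eventually_mvfderiv_eq_fderiv_chart hf,
        extChartAt_source_mem_nhds (I := 𝓘(ℝ, E)) x] with y hy hys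
      rw [hy]
      exact congrArg _ (chartField_apply Z hys).symm
  rw [mvfderiv, hderiv.mfderiv, chartField_apply W (mem_extChartAt_source x)]
  exact add_comm _ _

theorem mvfderiv_mlieBracket [CompleteSpace E] (hf : ContMDiffAt 𝓘(ℝ, E) 𝓘(ℝ, F) ∞ f x)
    {X Y : Π y : M, TangentSpace 𝓘(ℝ, E) y} (hX : MDiffAt (T% X) x) (hY : MDiffAt (T% Y) x) :
    d% f x (mlieBracket 𝓘(ℝ, E) X Y x) =
      d% (fun y => d% f y (Y y)) x (X x) - d% (fun y => d% f y (X y)) x (Y x) := by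
  have hsymm := (contDiffAt_comp_extChartAt_symm hf).isSymmSndFDerivAt
    (by simpa using ENat.LEInfty.out)
  rw [mvfderiv_mvfderiv_eq_fderiv_chart hf hY X, mvfderiv_mvfderiv_eq_fderiv_chart hf hX Y,
    (eventually_mvfderiv_eq_fderiv_chart hf).self_of_nhds, mfderiv_extChartAt_mlieBracket,
    hsymm.eq, lieBracket, map_sub]
  abel

end LieBracket

section CovDerivEnd

variable {E : Type*} [NormedAddCommGroup E] [NormedSpace ℝ E]
  {M : Type*} [TopologicalSpace M] [ChartedSpace E M] [IsManifold 𝓘(ℝ, E) ∞ M]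

theorem covDerivEnd_tensorial (D : AffineConnection E M) {A : EndField E M} {x : M}
    (hA : SmoothEndAt A x) : TensorialAt 𝓘(ℝ, E) E (fun Y => covDerivEnd D A Y x) x where
  smul {f Y} hf hY := by
    have h : (fun y => A y ((f • Y) y)) = f • fun y => A y (Y y) :=
      funext fun y => map_smul (A y) (f y) (Y y)
    rw [covDerivEnd, covDerivEnd, h, D.isCovariantDerivativeOn.leibniz (hA.mdiffAt_apply hY) hf
      (Set.mem_univ x), D.isCovariantDerivativeOn.leibniz hY hf (Set.mem_univ x)]
    ext u
    simp [smul_sub]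
  add {Y Y'} hY hY' := by
    have h : (fun y => A y ((Y + Y') y)) = (fun y => A y (Y y)) + fun y => A y (Y' y) :=
      funext fun y => map_add (A y) (Y y) (Y' y)
    rw [covDerivEnd, covDerivEnd, covDerivEnd, h, D.isCovariantDerivativeOn.add
      (hA.mdiffAt_apply hY) (hA.mdiffAt_apply hY') (Set.mem_univ x),
      D.isCovariantDerivativeOn.add hY hY' (Set.mem_univ x), ContinuousLinearMap.comp_add]
    abel

variable [FiniteDimensional ℝ E]

theorem leviCivita_isLeviCivita (g : RiemMetric E M) : IsLeviCivita g (leviCivita g) :=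
  (exists_isLeviCivita g).choose_spec

theorem IsLeviCivita.sub_eq_mlieBracket {g : RiemMetric E M} {D : AffineConnection E M}
    (h : IsLeviCivita g D) {X Y : Π y : M, TangentSpace 𝓘(ℝ, E) y} {x : M}
    (hX : MDiffAt (T% X) x) (hY : MDiffAt (T% Y) x) :
    D Y x (X x) - D X x (Y x) = mlieBracket 𝓘(ℝ, E) X Y x :=
  D.torsion_eq_zero_iff.1 h.torsion_eq_zero hX hY

variable {D : AffineConnection E M} {A : EndField E M} {x : M}

/-- The covariant derivative of a smooth field of endomorphisms `A`, as a tensor: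
`covDerivTensor D hA v u` is `(∇_u A) v`. -/
def covDerivTensor (D : AffineConnection E M) {A : EndField E M} {x : M} (hA : SmoothEndAt A x) :
    TangentSpace 𝓘(ℝ, E) x →L[ℝ] TangentSpace 𝓘(ℝ, E) x →L[ℝ] TangentSpace 𝓘(ℝ, E) x :=
  TensorialAt.mkHom (fun Y => covDerivEnd D A Y x) x (covDerivEnd_tensorial D hA)

theorem connection_endField_apply (D : AffineConnection E M) (hA : SmoothEndAt A x)
    {Y : Π y : M, TangentSpace 𝓘(ℝ, E) y} (hY : MDiffAt (T% Y) x) (u : TangentSpace 𝓘(ℝ, E) x) :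
    D (fun y => A y (Y y)) x u = covDerivTensor D hA (Y x) u + A x (D Y x u) := by
  rw [covDerivTensor, TensorialAt.mkHom_apply (covDerivEnd_tensorial D hA) hY]
  exact (sub_add_cancel _ _).symm

theorem covDerivTensor_of_idem (D : AffineConnection E M) (hA : SmoothEndAt A x)
    (hidem : ∀ y u, A y (A y u) = A y u) (u v : TangentSpace 𝓘(ℝ, E) x) :
    A x (covDerivTensor D hA v u) + covDerivTensor D hA (A x v) u = covDerivTensor D hA v u := by
  have hY : MDiffAt (T% (extend E v : Π y : M, TangentSpace 𝓘(ℝ, E) y)) x :=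
    mdifferentiableAt_extend ..
  have hAY := connection_endField_apply D hA hY u
  have hAAY := connection_endField_apply D hA (hA.mdiffAt_apply hY) u
  simp only [hidem, extend_apply_self] at hAY hAAY
  rw [hAY, map_add, hidem] at hAAY
  rw [add_comm]
  exact (add_right_cancel (hAAY.trans (add_assoc ..).symm)).symm

theorem covDerivTensor_of_symm {g : RiemMetric E M} (hD : IsLeviCivita g D) (hA : SmoothEndAt A x)
    (hsymm : ∀ y u v, g.inner y (A y u) v = g.inner y u (A y v))
    (u v w : TangentSpace 𝓘(ℝ, E) x) :
    g.inner x (covDerivTensor D hA v u) w = g.inner x v (covDerivTensor D hA w u) := by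
  have hext : ∀ v : TangentSpace 𝓘(ℝ, E) x,
      MDiffAt (T% (extend E v : Π y : M, TangentSpace 𝓘(ℝ, E) y)) x :=
    fun v => mdifferentiableAt_extend ..
  have hleft := hD.metric x _ _ u (hA.mdiffAt_apply (hext v)) (hext w)
  have hright := hD.metric x _ _ u (hext v) (hA.mdiffAt_apply (hext w))
  simp only [hsymm] at hleft
  rw [hleft, connection_endField_apply D hA (hext v), connection_endField_apply D hA (hext w)]
    at hright
  simp only [extend_apply_self, map_add, add_apply, hsymm] at hright
  linarith

theorem covDerivTensor_comm {J : EndField E M} (hA : SmoothEndAt A x) (hJ : SmoothEndAt J x)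
    (hpar : ∀ Y : Π y : M, TangentSpace 𝓘(ℝ, E) y, MDiffAt (T% Y) x → covDerivEnd D J Y x = 0)
    (hcomm : ∀ y u, A y (J y u) = J y (A y u)) (u v : TangentSpace 𝓘(ℝ, E) x) :
    covDerivTensor D hA (J x v) u = J x (covDerivTensor D hA v u) := by
  have hY : MDiffAt (T% (extend E v : Π y : M, TangentSpace 𝓘(ℝ, E) y)) x :=
    mdifferentiableAt_extend ..
  have hDJ : ∀ Y : Π y : M, TangentSpace 𝓘(ℝ, E) y, MDiffAt (T% Y) x →
      D (fun y => J y (Y y)) x u = J x (D Y x u) :=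
    fun Y hY => sub_eq_zero.1 congr($(hpar Y hY) u)
  have hAJ := connection_endField_apply D hA (hJ.mdiffAt_apply hY) u
  simp only [hcomm] at hAJ
  rw [hDJ _ (hA.mdiffAt_apply hY), connection_endField_apply D hA hY, hDJ _ hY, hcomm,
    map_add, extend_apply_self] at hAJ
  exact (add_right_cancel hAJ).symm

end CovDerivEnd

section OrthogonalProjection

variable {E : Type*} [NormedAddCommGroup E] [NormedSpace ℝ E]
  {M : Type*} [TopologicalSpace M] [ChartedSpace E M]

/-- The field of endomorphisms `1 - P`. -/
def complField (P : EndField E M) : EndField E M :=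
  fun x => ContinuousLinearMap.id ℝ (TangentSpace 𝓘(ℝ, E) x) - P x

theorem complField_apply (P : EndField E M) (x : M) (u : TangentSpace 𝓘(ℝ, E) x) :
    complField P x u = u - P x u := rfl

theorem complField_complField (P : EndField E M) : complField (complField P) = P :=
  funext fun _ => sub_sub_cancel _ _

variable [IsManifold 𝓘(ℝ, E) ∞ M]

/-- `P` is a smooth field of `g`-orthogonal projections of the tangent spaces of `M`. -/
structure IsOrthogonalProjection (g : RiemMetric E M) (P : EndField E M) : Prop where
  smooth : ∀ x, SmoothEndAt P x
  idem : ∀ x u, P x (P x u) = P x u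
  symm : ∀ x u v, g.inner x (P x u) v = g.inner x u (P x v)

theorem IsOrthogonalProjection.compl {g : RiemMetric E M} {P : EndField E M}
    (h : IsOrthogonalProjection g P) : IsOrthogonalProjection g (complField P) where
  smooth x := (smoothEndAt_id x).sub (h.smooth x)
  idem x u := by simp only [complField_apply, map_sub, h.idem, sub_self, sub_zero]
  symm x u v := by simp only [complField_apply, map_sub, sub_apply, h.symm]

theorem IsOrthogonalProjection.inner_apply_self_eq_zero {g : RiemMetric E M} {P : EndField E M}
    (h : IsOrthogonalProjection g P) {x : M} {u : TangentSpace 𝓘(ℝ, E) x} :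
    g.inner x (P x u) u = 0 ↔ P x u = 0 := by
  refine ⟨fun hu => ?_, fun hu => by rw [hu, map_zero, zero_apply]⟩
  rw [← h.idem, h.symm] at hu
  by_contra hne
  exact (g.pos x _ hne).ne' hu

/-- The Schouten–van Kampen connection `Y ↦ P ∇(PY) + (1 - P) ∇((1 - P)Y)` of a connection `∇` and
a field of projections `P`. -/
def splitConnection (D : AffineConnection E M) (P : EndField E M)
    (Y : Π y : M, TangentSpace 𝓘(ℝ, E) y) (x : M) :
    TangentSpace 𝓘(ℝ, E) x →L[ℝ] TangentSpace 𝓘(ℝ, E) x :=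
  (P x).comp (D (fun y => P y (Y y)) x)
    + (complField P x).comp (D (fun y => complField P y (Y y)) x)

theorem splitConnection_complField (D : AffineConnection E M) (P : EndField E M) :
    splitConnection D (complField P) = splitConnection D P := by
  funext Y x
  rw [splitConnection, complField_complField, add_comm, splitConnection]

theorem proj_splitConnection {P : EndField E M} {x : M} (hidem : ∀ u, P x (P x u) = P x u)
    (D : AffineConnection E M) (Y : Π y : M, TangentSpace 𝓘(ℝ, E) y)
    (u : TangentSpace 𝓘(ℝ, E) x) :
    P x (splitConnection D P Y x u) = P x (D (fun y => P y (Y y)) x u) := by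
  simp only [splitConnection, add_apply, ContinuousLinearMap.comp_apply, complField_apply, map_add,
    map_sub, hidem, sub_self, add_zero]

theorem splitConnection_apply [FiniteDimensional ℝ E] {P : EndField E M} {x : M}
    (hP : SmoothEndAt P x) (hidem : ∀ y u, P y (P y u) = P y u) (D : AffineConnection E M)
    {Y : Π y : M, TangentSpace 𝓘(ℝ, E) y} (hY : MDiffAt (T% Y) x) (u : TangentSpace 𝓘(ℝ, E) x) :
    splitConnection D P Y x u =
      D Y x u + covDerivTensor D hP (Y x - (2 : ℝ) • P x (Y x)) u := by
  have hPY := hP.mdiffAt_apply hY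
  have hcompl : D (fun y => complField P y (Y y)) x = D Y x - D (fun y => P y (Y y)) x := by
    have hadd := D.isCovariantDerivativeOn.add (((smoothEndAt_id x).sub hP).mdiffAt_apply hY) hPY
      (Set.mem_univ x)
    rw [eq_sub_iff_add_eq]
    exact hadd.symm.trans <| congrArg (D · x) (funext fun y => sub_add_cancel (Y y) (P y (Y y)))
  have hS := covDerivTensor_of_idem D hP hidem u (Y x)
  rw [splitConnection, hcompl, add_apply, ContinuousLinearMap.comp_apply,
    ContinuousLinearMap.comp_apply, sub_apply, complField_apply,
    connection_endField_apply D hP hY]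
  simp only [map_sub, map_add, map_smul, sub_apply, smul_apply, hidem]
  rw [eq_sub_iff_add_eq.2 hS]
  module

theorem isParallelDistribution_ker {P : EndField E M} (hidem : ∀ x u, P x (P x u) = P x u)
    (D : AffineConnection E M) {D' : (Π y : M, TangentSpace 𝓘(ℝ, E) y) → EndField E M}
    (hD' : ∀ x (Y : Π y : M, TangentSpace 𝓘(ℝ, E) y), MDiffAt (T% Y) x →
      D' Y x = splitConnection D P Y x) :
    IsParallelDistribution D' fun x => LinearMap.ker (P x).toLinearMap := by
  intro x Y hY hPY u
  have hPY : (fun y => P y (Y y)) = 0 := funext hPY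
  change P x (D' Y x u) = 0
  rw [hD' x Y hY, proj_splitConnection (hidem x), hPY, D.zero, Pi.zero_apply, zero_apply, map_zero]

/-- The symmetric bilinear form `B` is parallel for `D`. By polarization it is enough to
differentiate the quadratic form. -/
structure IsParallelForm (D : (Π y : M, TangentSpace 𝓘(ℝ, E) y) → EndField E M)
    (B : BilinField E M) : Prop where
  smooth : ∀ x, SmoothBilinAt B x
  symm : ∀ x u v, B x u v = B x v u
  deriv_apply_self : ∀ (x : M) (Y : Π y : M, TangentSpace 𝓘(ℝ, E) y)
    (u : TangentSpace 𝓘(ℝ, E) x), MDiffAt (T% Y) x →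
      d% (fun y => B y (Y y) (Y y)) x u = 2 * B x (D Y x u) (Y x)

theorem IsOrthogonalProjection.isParallelForm [FiniteDimensional ℝ E] {g : RiemMetric E M}
    {P : EndField E M} (h : IsOrthogonalProjection g P) {D : AffineConnection E M}
    (hD : IsLeviCivita g D) {D' : (Π y : M, TangentSpace 𝓘(ℝ, E) y) → EndField E M}
    (hD' : ∀ x (Y : Π y : M, TangentSpace 𝓘(ℝ, E) y), MDiffAt (T% Y) x →
      D' Y x = splitConnection D P Y x) :
    IsParallelForm D' fun x => (g.inner x).comp (P x) where
  smooth x := (g.smoothBilinAt x).comp (h.smooth x)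
  symm x u v := (h.symm x u v).trans (g.symm x _ _)
  deriv_apply_self x Y u hY := by
    have hPY := (h.smooth x).mdiffAt_apply hY
    have hself : (fun y => g.inner y (P y (Y y)) (Y y)) =
        fun y => g.inner y (P y (Y y)) (P y (Y y)) :=
      funext fun y => by rw [← h.symm, h.idem]
    simp only [ContinuousLinearMap.comp_apply]
    rw [hself, hD.metric x _ _ u hPY hPY, hD' x Y hY, proj_splitConnection (h.idem x),
      h.symm x (D _ x u), g.symm x (P x (Y x)), two_mul]

end OrthogonalProjection

section Holonomy

variable {E : Type*} [NormedAddCommGroup E] [NormedSpace ℝ E]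
  {M : Type*} [TopologicalSpace M] [ChartedSpace E M] [IsManifold 𝓘(ℝ, E) ∞ M]

namespace IsParallelForm

variable {D : (Π y : M, TangentSpace 𝓘(ℝ, E) y) → EndField E M} {B : BilinField E M}

theorem hasDerivWithinAt_along (hB : IsParallelForm D B) {c : ℝ → M} {I : Set ℝ} {t : ℝ}
    (ht : t ∈ I) (hc : MDifferentiableWithinAt 𝓘(ℝ, ℝ) 𝓘(ℝ, E) c I t)
    {Y : Π s : ℝ, TangentSpace 𝓘(ℝ, E) (c s)}
    (hY : DifferentiableWithinAt ℝ (alongCoord c Y t) I t) :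
    HasDerivWithinAt (fun s => B (c s) (Y s) (Y s))
      (2 * B (c t) (covDerivAlong D c I Y t) (Y t)) I t := by
  have hv : HasMFDerivWithinAt 𝓘(ℝ, ℝ) 𝓘(ℝ, E) (alongCoord c Y t) I t
      (ContinuousLinearMap.toSpanSingleton ℝ (derivWithin (alongCoord c Y t) I t) : ℝ →L[ℝ] E) :=
    hY.hasDerivWithinAt.hasFDerivWithinAt.hasMFDerivWithinAt
  obtain ⟨f', hf', hf'_apply⟩ := (hB.smooth (c t)).exists_hasMFDerivWithinAt_along
    hc.hasMFDerivWithinAt Y Y hv hv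
  rw [Set.insert_eq_of_mem ht] at hf'
  have hext := hB.deriv_apply_self (c t) (extend E (Y t))
    (mfderivWithin 𝓘(ℝ, ℝ) 𝓘(ℝ, E) c I t (1 : ℝ)) (mdifferentiableAt_extend ..)
  rw [extend_apply_self] at hext
  have hone : f' 1 = 2 * B (c t) (covDerivAlong D c I Y t) (Y t) := by
    rw [covDerivAlong, map_add, add_apply, mul_add]
    refine (hf'_apply 1).trans
      ((congrArg₂ (· + ·) (congrArg₂ (· + ·) hext rfl) (hB.symm _ _ _)).trans ?_)
    rw [ContinuousLinearMap.toSpanSingleton_apply, one_smul]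
    ring
  have hf'_fderiv : HasFDerivWithinAt (fun s => B (c s) (Y s) (Y s)) f' I t :=
    hasMFDerivWithinAt_iff_hasFDerivWithinAt.1 hf'
  exact hone ▸ hf'_fderiv.hasDerivWithinAt

theorem apply_eq_of_isParallelAlong (hB : IsParallelForm D B) {c : ℝ → M} {a b : ℝ} (hab : a < b)
    (hc : ContMDiffOn 𝓘(ℝ, ℝ) 𝓘(ℝ, E) 1 c (Set.Icc a b))
    {Y : Π s : ℝ, TangentSpace 𝓘(ℝ, E) (c s)} (hY : IsParallelAlong D c (Set.Icc a b) Y) :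
    B (c b) (Y b) (Y b) = B (c a) (Y a) (Y a) := by
  have hderiv : ∀ t ∈ Set.Icc a b,
      HasDerivWithinAt (fun s => B (c s) (Y s) (Y s)) 0 (Set.Icc a b) t := by
    intro t ht
    obtain ⟨hd, hzero⟩ := hY t ht
    have := hB.hasDerivWithinAt_along ht ((hc t ht).mdifferentiableWithinAt one_ne_zero) hd
    rwa [hzero, map_zero, zero_apply, mul_zero] at this
  exact constant_of_derivWithin_zero (f := fun s => B (c s) (Y s) (Y s))
    (fun t ht => (hderiv t ht).differentiableWithinAt)
    (fun t ht => (hderiv t (Set.Ico_subset_Icc_self ht)).derivWithin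
      (uniqueDiffOn_Icc hab t (Set.Ico_subset_Icc_self ht))) b (Set.right_mem_Icc.2 hab.le)

theorem apply_eq_of_isParallelTransport (hB : IsParallelForm D B) {x y : M}
    {τ : TangentSpace 𝓘(ℝ, E) x →ₗ[ℝ] TangentSpace 𝓘(ℝ, E) y} (hτ : IsParallelTransport D x y τ)
    (u : TangentSpace 𝓘(ℝ, E) x) : B y (τ u) (τ u) = B x u u := by
  induction hτ with
  | curve c a b hab hc τ hτ =>
    obtain ⟨Y, hY, rfl, hYb⟩ := hτ u
    rw [← hYb, hB.apply_eq_of_isParallelAlong hab hc hY]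
  | trans x y z σ τ _ _ hσ hτ => exact (hτ (σ u)).trans (hσ u)

theorem apply_eq_of_mem_holonomyGroup (hB : IsParallelForm D B) {x : M}
    {τ : TangentSpace 𝓘(ℝ, E) x ≃ₗ[ℝ] TangentSpace 𝓘(ℝ, E) x} (hτ : τ ∈ holonomyGroup D x)
    (u : TangentSpace 𝓘(ℝ, E) x) : B x (τ u) (τ u) = B x u u := by
  induction hτ using Subgroup.closure_induction generalizing u with
  | mem τ hτ => exact hB.apply_eq_of_isParallelTransport hτ u
  | one => rfl
  | mul σ τ _ _ hσ hτ => exact (hσ (τ u)).trans (hτ u)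
  | inv τ _ hτ =>
    rw [← hτ (τ⁻¹ u)]
    exact congrArg (fun w => B x w w) (τ.apply_symm_apply u)

end IsParallelForm

theorem IsOrthogonalProjection.holonomyGroup_preserves_ker [FiniteDimensional ℝ E]
    {g : RiemMetric E M} {P : EndField E M} (h : IsOrthogonalProjection g P)
    {D : AffineConnection E M} (hD : IsLeviCivita g D)
    {D' : (Π y : M, TangentSpace 𝓘(ℝ, E) y) → EndField E M}
    (hD' : ∀ x (Y : Π y : M, TangentSpace 𝓘(ℝ, E) y), MDiffAt (T% Y) x →
      D' Y x = splitConnection D P Y x) {x : M}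
    {τ : TangentSpace 𝓘(ℝ, E) x ≃ₗ[ℝ] TangentSpace 𝓘(ℝ, E) x} (hτ : τ ∈ holonomyGroup D' x)
    {u : TangentSpace 𝓘(ℝ, E) x} (hu : P x u = 0) : P x (τ u) = 0 :=
  h.inner_apply_self_eq_zero.1
    (((h.isParallelForm hD hD').apply_eq_of_mem_holonomyGroup hτ u).trans
      (h.inner_apply_self_eq_zero.2 hu))

end Holonomy

section KahlerFoliation

variable {E : Type*} [NormedAddCommGroup E] [NormedSpace ℝ E]
  {M : Type*} [TopologicalSpace M] [ChartedSpace E M] [IsManifold 𝓘(ℝ, E) ∞ M]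
  {g : RiemMetric E M} {P J : EndField E M} {x : M}

theorem IsAlmostHermitian.inner_left (hJ : IsAlmostHermitian g J) (u v : TangentSpace 𝓘(ℝ, E) x) :
    g.inner x (J x u) v = -g.inner x u (J x v) := by
  rw [← hJ.compatible x u, hJ.sq, map_neg, neg_neg]

variable [FiniteDimensional ℝ E]

theorem IsKahler.leviCivita_apply (hJ : IsKahler g J) {Y : Π y : M, TangentSpace 𝓘(ℝ, E) y}
    (hY : MDiffAt (T% Y) x) (u : TangentSpace 𝓘(ℝ, E) x) :
    leviCivita g (fun y => J y (Y y)) x u = J x (leviCivita g Y x u) :=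
  sub_eq_zero.1 congr($(hJ.parallel x Y hY) u)

/-- A totally geodesic Riemannian foliation of the Kähler manifold `(M, g, J)` by complex
submanifolds, encoded by the orthogonal projection `P` on its tangent spaces. The condition
`bundleLike` expresses that `g` is constant on the leaves in the directions orthogonal to them. -/
structure IsKahlerFoliation (g : RiemMetric E M) (J P : EndField E M) : Prop where
  proj : IsOrthogonalProjection g P
  kahler : IsKahler g J
  comm : ∀ x u, P x (J x u) = J x (P x u)
  totallyGeodesic : ∀ (x : M) (W : Π y : M, TangentSpace 𝓘(ℝ, E) y), MDiffAt (T% W) x →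
    (∀ y, P y (W y) = W y) → ∀ u, P x u = u → P x (leviCivita g W x u) = leviCivita g W x u
  bundleLike : ∀ (x : M) (W : Π y : M, TangentSpace 𝓘(ℝ, E) y), MDiffAt (T% W) x →
    (∀ y, P y (W y) = W y) → ∀ u, P x u = 0 → g.inner x (leviCivita g W x u) u = 0

namespace IsKahlerFoliation

/-- The tensor `projDeriv x v u = (∇_u P) v`, which combines the second fundamental form of the
leaves with O'Neill's integrability tensor of the orthogonal distribution. -/
def projDeriv (h : IsKahlerFoliation g J P) (x : M) :
    TangentSpace 𝓘(ℝ, E) x →L[ℝ] TangentSpace 𝓘(ℝ, E) x →L[ℝ] TangentSpace 𝓘(ℝ, E) x :=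
  covDerivTensor (leviCivita g) (h.proj.smooth x)

theorem leviCivita_proj_apply (h : IsKahlerFoliation g J P)
    {Y : Π y : M, TangentSpace 𝓘(ℝ, E) y} (hY : MDiffAt (T% Y) x) (u : TangentSpace 𝓘(ℝ, E) x) :
    leviCivita g (fun y => P y (Y y)) x u = h.projDeriv x (Y x) u + P x (leviCivita g Y x u) :=
  connection_endField_apply _ _ hY u

theorem proj_projDeriv_add (h : IsKahlerFoliation g J P) (u v : TangentSpace 𝓘(ℝ, E) x) :
    P x (h.projDeriv x v u) + h.projDeriv x (P x v) u = h.projDeriv x v u :=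
  covDerivTensor_of_idem _ _ h.proj.idem u v

theorem proj_projDeriv (h : IsKahlerFoliation g J P) (u v : TangentSpace 𝓘(ℝ, E) x) :
    P x (h.projDeriv x v u) = h.projDeriv x (v - P x v) u := by
  rw [map_sub, sub_apply, eq_sub_iff_add_eq, h.proj_projDeriv_add]

theorem proj_projDeriv_proj (h : IsKahlerFoliation g J P) (u v : TangentSpace 𝓘(ℝ, E) x) :
    P x (h.projDeriv x (P x v) u) = 0 := by
  rw [h.proj_projDeriv, h.proj.idem, sub_self, map_zero, zero_apply]

theorem inner_projDeriv (h : IsKahlerFoliation g J P) (u v w : TangentSpace 𝓘(ℝ, E) x) :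
    g.inner x (h.projDeriv x v u) w = g.inner x v (h.projDeriv x w u) :=
  covDerivTensor_of_symm (leviCivita_isLeviCivita g) _ h.proj.symm u v w

theorem inner_projDeriv_proj (h : IsKahlerFoliation g J P) (u v w : TangentSpace 𝓘(ℝ, E) x) :
    g.inner x (h.projDeriv x (P x v) u) w = g.inner x v (h.projDeriv x (w - P x w) u) := by
  rw [h.inner_projDeriv, h.proj.symm, h.proj_projDeriv]

theorem projDeriv_J (h : IsKahlerFoliation g J P) (u v : TangentSpace 𝓘(ℝ, E) x) :
    h.projDeriv x (J x v) u = J x (h.projDeriv x v u) :=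
  covDerivTensor_comm _ (h.kahler.almostHermitian.smooth x) (h.kahler.parallel x) h.comm u v

theorem exists_projDeriv_proj_eq (h : IsKahlerFoliation g J P) (u v : TangentSpace 𝓘(ℝ, E) x) :
    ∃ W : Π y : M, TangentSpace 𝓘(ℝ, E) y, MDiffAt (T% W) x ∧ (∀ y, P y (W y) = W y) ∧
      h.projDeriv x (P x v) u = leviCivita g W x u - P x (leviCivita g W x u) := by
  have hW : MDiffAt (T% (fun y => P y (extend E v y))) x :=
    (h.proj.smooth x).mdiffAt_apply (mdifferentiableAt_extend ..)
  refine ⟨_, hW, fun y => h.proj.idem y _, ?_⟩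
  have hPW := h.leviCivita_proj_apply hW u
  simp only [h.proj.idem, extend_apply_self] at hPW
  exact eq_sub_of_add_eq hPW.symm

theorem projDeriv_apply_proj (h : IsKahlerFoliation g J P) (u v : TangentSpace 𝓘(ℝ, E) x) :
    h.projDeriv x v (P x u) = 0 := by
  have hleaf : ∀ w, h.projDeriv x (P x w) (P x u) = 0 := by
    intro w
    obtain ⟨W, hW, hPW, heq⟩ := h.exists_projDeriv_proj_eq (P x u) w
    rw [heq, h.totallyGeodesic x W hW hPW _ (h.proj.idem x u), sub_self]
  refine g.ext_inner fun w => ?_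
  rw [← h.proj_projDeriv_add, hleaf, add_zero, h.proj.symm, h.inner_projDeriv, hleaf, map_zero,
    map_zero, zero_apply]

theorem projDeriv_self (h : IsKahlerFoliation g J P) {u : TangentSpace 𝓘(ℝ, E) x}
    (hu : P x u = 0) : h.projDeriv x u u = 0 := by
  refine g.ext_inner fun w => ?_
  obtain ⟨W, hW, hPW, heq⟩ := h.exists_projDeriv_proj_eq u w
  rw [← h.proj_projDeriv_add, hu, map_zero, zero_apply, add_zero, h.proj.symm, h.inner_projDeriv,
    heq, map_sub, ← h.proj.symm, hu, g.symm, h.bundleLike x W hW hPW u hu]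
  simp only [map_zero, zero_apply, sub_zero]

theorem projDeriv_compl_skew (h : IsKahlerFoliation g J P) (u v : TangentSpace 𝓘(ℝ, E) x) :
    h.projDeriv x (v - P x v) u = -h.projDeriv x (u - P x u) v := by
  have hker : ∀ w, P x (w - P x w) = 0 := fun w => by rw [map_sub, h.proj.idem, sub_self]
  have hcompl : ∀ a b, h.projDeriv x a (b - P x b) = h.projDeriv x a b := fun a b => by
    rw [map_sub, h.projDeriv_apply_proj, sub_zero]
  have hsum := h.projDeriv_self (u := (u - P x u) + (v - P x v))
    (by rw [map_add, hker, hker, add_zero])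
  simp only [map_add, add_apply, h.projDeriv_self (hker _), zero_add, add_zero, hcompl] at hsum
  exact eq_neg_of_add_eq_zero_left hsum

theorem projDeriv_compl_apply_J (h : IsKahlerFoliation g J P) (u w : TangentSpace 𝓘(ℝ, E) x) :
    h.projDeriv x (w - P x w) (J x u) = J x (h.projDeriv x (w - P x w) u) := by
  rw [h.projDeriv_compl_skew, h.comm, ← map_sub, h.projDeriv_J, ← map_neg,
    ← h.projDeriv_compl_skew]

theorem projDeriv_proj_apply_J (h : IsKahlerFoliation g J P) (u v : TangentSpace 𝓘(ℝ, E) x) :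
    h.projDeriv x (P x v) (J x u) = -J x (h.projDeriv x (P x v) u) := by
  refine g.ext_inner fun w => ?_
  rw [map_neg, neg_apply, h.kahler.almostHermitian.inner_left, neg_neg, h.inner_projDeriv_proj,
    h.inner_projDeriv_proj, h.comm, ← map_sub, h.projDeriv_J, h.projDeriv_compl_apply_J]

end IsKahlerFoliation

end KahlerFoliation

section Squashing

variable {E : Type*} [NormedAddCommGroup E] [NormedSpace ℝ E]
  {M : Type*} [TopologicalSpace M] [ChartedSpace E M] {P J : EndField E M} {x : M}

/-- The field of endomorphisms `J` with the sign reversed on the range of the projection `P`. -/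
def reversedOn (P J : EndField E M) : EndField E M :=
  fun x => (J x).comp (complField P x) - (J x).comp (P x)

theorem reversedOn_apply (P J : EndField E M) (x : M) (u : TangentSpace 𝓘(ℝ, E) x) :
    reversedOn P J x u = J x (u - (2 : ℝ) • P x u) := by
  rw [reversedOn, sub_apply, ContinuousLinearMap.comp_apply, ContinuousLinearMap.comp_apply,
    complField_apply, ← map_sub, sub_sub, two_smul]

theorem proj_reflection (hidem : ∀ u, P x (P x u) = P x u) (u : TangentSpace 𝓘(ℝ, E) x) :
    P x (u - (2 : ℝ) • P x u) = -P x u := by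
  rw [map_sub, map_smul, hidem]
  module

theorem proj_reversedOn (hidem : ∀ u, P x (P x u) = P x u) (hcomm : ∀ u, P x (J x u) = J x (P x u))
    (u : TangentSpace 𝓘(ℝ, E) x) : P x (reversedOn P J x u) = -J x (P x u) := by
  rw [reversedOn_apply, hcomm, proj_reflection hidem, map_neg]

variable [IsManifold 𝓘(ℝ, E) ∞ M] {g g' : RiemMetric E M}

theorem smoothEndAt_reversedOn (hP : SmoothEndAt P x) (hJ : SmoothEndAt J x) :
    SmoothEndAt (reversedOn P J) x :=
  (hJ.comp ((smoothEndAt_id x).sub hP)).sub (hJ.comp hP)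

/-- The metric `g'` is obtained from `g` by halving it on the range of the orthogonal
projection `P`. -/
def IsSquashing (g : RiemMetric E M) (P : EndField E M) (g' : RiemMetric E M) : Prop :=
  ∀ x u v, g'.inner x u v = g.inner x u v - 1 / 2 * g.inner x (P x u) v

theorem isAlmostHermitian_reversedOn (hg' : IsSquashing g P g') (hP : IsOrthogonalProjection g P)
    (hJ : IsAlmostHermitian g J) (hcomm : ∀ x u, P x (J x u) = J x (P x u)) :
    IsAlmostHermitian g' (reversedOn P J) where
  smooth x := smoothEndAt_reversedOn (hP.smooth x) (hJ.smooth x)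
  sq x u := by
    rw [reversedOn_apply, proj_reversedOn (hP.idem x) (hcomm x), reversedOn_apply, smul_neg,
      sub_neg_eq_add, ← map_smul (J x), ← map_add (J x), sub_add_cancel, hJ.sq]
  compatible x u v := by
    have hsymm := hP.symm x u v
    have hidem : g.inner x (P x u) (P x v) = g.inner x (P x u) v := by rw [← hP.symm, hP.idem]
    rw [hg', hg', proj_reversedOn (hP.idem x) (hcomm x), reversedOn_apply, reversedOn_apply,
      ← map_neg (J x), hJ.compatible, hJ.compatible]
    simp only [map_sub, map_smul, map_neg, sub_apply, smul_apply, neg_apply, smul_eq_mul]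
    linarith

variable [FiniteDimensional ℝ E]

namespace IsKahlerFoliation

/-- The difference of the Levi-Civita connections of the squashed metric and of `g`, namely
`∇̂_u Y - ∇_u Y = -½ ((∇_u P) P Y + (∇_Y P) P u)`. -/
def squashedDifference (h : IsKahlerFoliation g J P) (x : M) :
    TangentSpace 𝓘(ℝ, E) x →L[ℝ] TangentSpace 𝓘(ℝ, E) x →L[ℝ] TangentSpace 𝓘(ℝ, E) x :=
  have : FiniteDimensional ℝ (TangentSpace 𝓘(ℝ, E) x) := inferInstanceAs (FiniteDimensional ℝ E)
  have : T2Space (TangentSpace 𝓘(ℝ, E) x) := inferInstanceAs (T2Space E)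
  (LinearMap.mk₂ ℝ (fun v u : TangentSpace 𝓘(ℝ, E) x => (-(1 / 2) : ℝ) •
      (h.projDeriv x (P x v) u + h.projDeriv x (P x u) v))
    (fun _ _ _ => by simp only [map_add, add_apply]; module)
    (fun _ _ _ => by simp only [map_smul, smul_apply]; module)
    (fun _ _ _ => by simp only [map_add, add_apply]; module)
    (fun _ _ _ => by simp only [map_smul, smul_apply]; module)).toContinuousBilinearMap

theorem squashedDifference_apply (h : IsKahlerFoliation g J P) (u v : TangentSpace 𝓘(ℝ, E) x) :
    h.squashedDifference x v u =
      (-(1 / 2) : ℝ) • (h.projDeriv x (P x v) u + h.projDeriv x (P x u) v) := rfl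

theorem proj_squashedDifference (h : IsKahlerFoliation g J P) (u v : TangentSpace 𝓘(ℝ, E) x) :
    P x (h.squashedDifference x v u) = 0 := by
  rw [squashedDifference_apply, map_smul, map_add, h.proj_projDeriv_proj, h.proj_projDeriv_proj,
    add_zero, smul_zero]

theorem inner_squashedDifference_add (h : IsKahlerFoliation g J P)
    (u v w : TangentSpace 𝓘(ℝ, E) x) :
    g.inner x (h.squashedDifference x v u) w + g.inner x v (h.squashedDifference x w u) =
      -(1 / 2) * g.inner x (h.projDeriv x v u) w := by
  have hvw : g.inner x (h.projDeriv x (P x v) u) w + g.inner x v (h.projDeriv x (P x w) u) =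
      g.inner x (h.projDeriv x v u) w := by
    rw [← h.inner_projDeriv, h.inner_projDeriv_proj, h.inner_projDeriv, ← map_add, ← add_apply,
      ← map_add, sub_add_cancel, ← h.inner_projDeriv]
  have hskew :
      g.inner x (h.projDeriv x (P x u) v) w + g.inner x v (h.projDeriv x (P x u) w) = 0 := by
    rw [g.symm x v, h.inner_projDeriv_proj, h.inner_projDeriv_proj, h.projDeriv_compl_skew v w,
      map_neg, neg_add_cancel]
  simp only [squashedDifference_apply, map_smul, map_add, smul_apply, add_apply, smul_eq_mul]
  linarith

/-- The Levi-Civita connection of the squashed metric. -/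
def squashedConnection (h : IsKahlerFoliation g J P) : AffineConnection E M :=
  (leviCivita g).addOneForm h.squashedDifference

theorem squashedConnection_apply (h : IsKahlerFoliation g J P)
    (Y : Π y : M, TangentSpace 𝓘(ℝ, E) y) (u : TangentSpace 𝓘(ℝ, E) x) :
    h.squashedConnection Y x u = leviCivita g Y x u + h.squashedDifference x (Y x) u := rfl

theorem squashedConnection_torsion (h : IsKahlerFoliation g J P) :
    h.squashedConnection.torsion = 0 := by
  rw [CovariantDerivative.torsion_eq_zero_iff]
  intro X Y x hX hY
  rw [squashedConnection_apply, squashedConnection_apply,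
    ← (leviCivita_isLeviCivita g).sub_eq_mlieBracket hX hY, squashedDifference_apply,
    squashedDifference_apply]
  module

theorem squashedConnection_isLeviCivita (h : IsKahlerFoliation g J P) (hg' : IsSquashing g P g') :
    IsLeviCivita g' h.squashedConnection where
  torsion_eq_zero := h.squashedConnection_torsion
  metric x Y Z u hY hZ := by
    have hPY := (h.proj.smooth x).mdiffAt_apply hY
    have hconst : MDiffAt (fun _ : M => (-(1 / 2) : ℝ)) x := mdifferentiableAt_const
    have hinner : (fun y => g'.inner y (Y y) (Z y)) = fun y =>
        g.inner y (Y y) (Z y) + (-(1 / 2)) * g.inner y (P y (Y y)) (Z y) :=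
      funext fun y => by rw [hg']; ring
    have hdY := (leviCivita_isLeviCivita g).metric x _ _ u hY hZ
    have hdPY := (leviCivita_isLeviCivita g).metric x _ _ u hPY hZ
    rw [h.leviCivita_proj_apply hY] at hdPY
    have hdiff := h.inner_squashedDifference_add u (Y x) (Z x)
    have hsymm : g.inner x (P x (Y x)) (h.squashedDifference x (Z x) u) = 0 := by
      rw [h.proj.symm, h.proj_squashedDifference, map_zero]
    have hscaled : MDiffAt (fun y => (-(1 / 2)) * g.inner y (P y (Y y)) (Z y)) x :=
      hconst.mul (g.mdiffAt hPY hZ)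
    rw [hinner, mvfderiv_fun_add (g.mdiffAt hY hZ) hscaled,
      mvfderiv_fun_mul hconst (g.mdiffAt hPY hZ), squashedConnection_apply,
      squashedConnection_apply, hg', hg']
    simp only [map_add, add_apply, smul_apply, mvfderiv_const, smul_zero, zero_apply, smul_eq_mul,
      h.proj_squashedDifference, map_zero] at hdY hdPY ⊢
    linarith

theorem leviCivita_squashing_apply (h : IsKahlerFoliation g J P) (hg' : IsSquashing g P g')
    {Y : Π y : M, TangentSpace 𝓘(ℝ, E) y} (hY : MDiffAt (T% Y) x) (u : TangentSpace 𝓘(ℝ, E) x) :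
    leviCivita g' Y x u = leviCivita g Y x u + h.squashedDifference x (Y x) u :=
  congr($((leviCivita_isLeviCivita g').unique (h.squashedConnection_isLeviCivita hg') hY) u)

end IsKahlerFoliation

end Squashing

section NearlyKahler

variable {E : Type*} [NormedAddCommGroup E] [NormedSpace ℝ E] [FiniteDimensional ℝ E]
  {M : Type*} [TopologicalSpace M] [ChartedSpace E M] [IsManifold 𝓘(ℝ, E) ∞ M]
  {g g' : RiemMetric E M} {P J : EndField E M} {x : M}

namespace IsKahlerFoliation

theorem leviCivita_reversedOn_apply (h : IsKahlerFoliation g J P)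
    {Y : Π y : M, TangentSpace 𝓘(ℝ, E) y} (hY : MDiffAt (T% Y) x) (u : TangentSpace 𝓘(ℝ, E) x) :
    leviCivita g (fun y => reversedOn P J y (Y y)) x u =
      reversedOn P J x (leviCivita g Y x u) - (2 : ℝ) • J x (h.projDeriv x (Y x) u) := by
  have hJ := h.kahler.almostHermitian.smooth x
  have hPY := (h.proj.smooth x).mdiffAt_apply hY
  have hJPY : MDiffAt (T% (fun y => J y (P y (Y y)))) x := SmoothEndAt.mdiffAt_apply hJ hPY
  have hfun : (fun y => reversedOn P J y (Y y)) =
      (fun y => J y (Y y)) + (-2 : ℝ) • fun y => J y (P y (Y y)) := by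
    funext y
    rw [reversedOn_apply, map_sub, map_smul, sub_eq_add_neg, ← neg_smul]
    rfl
  have hscaled : MDiffAt (T% ((-2 : ℝ) • fun y => J y (P y (Y y)))) x :=
    mdifferentiableAt_const.smul_section hJPY
  rw [hfun, (leviCivita g).isCovariantDerivativeOn.add (SmoothEndAt.mdiffAt_apply hJ hY)
      hscaled (Set.mem_univ x),
    (leviCivita g).isCovariantDerivativeOn.smul_const _ hJPY (Set.mem_univ x), add_apply,
    smul_apply, h.kahler.leviCivita_apply hY, h.kahler.leviCivita_apply hPY,
    h.leviCivita_proj_apply hY, reversedOn_apply, map_sub, map_smul, map_add]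
  module

theorem squashedDifference_reversedOn (h : IsKahlerFoliation g J P)
    (u v : TangentSpace 𝓘(ℝ, E) x) :
    h.squashedDifference x (reversedOn P J x v) u = -J x (h.squashedDifference x v u) := by
  have hleaf : h.projDeriv x (P x (reversedOn P J x v)) u = -J x (h.projDeriv x (P x v) u) := by
    rw [proj_reversedOn (h.proj.idem x) (h.comm x), map_neg, neg_apply, h.projDeriv_J]
  have hnormal : h.projDeriv x (P x u) (reversedOn P J x v) = -J x (h.projDeriv x (P x u) v) := by
    rw [reversedOn_apply, h.projDeriv_proj_apply_J, map_sub, map_smul, h.projDeriv_apply_proj,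
      smul_zero, sub_zero]
  rw [squashedDifference_apply, squashedDifference_apply, hleaf, hnormal, ← neg_add, ← map_add,
    smul_neg, map_smul]

theorem covDerivEnd_reversedOn (h : IsKahlerFoliation g J P) (hg' : IsSquashing g P g')
    {Y : Π y : M, TangentSpace 𝓘(ℝ, E) y} (hY : MDiffAt (T% Y) x) (u : TangentSpace 𝓘(ℝ, E) x) :
    covDerivEnd (leviCivita g') (reversedOn P J) Y x u =
      J x ((-2 : ℝ) • (h.projDeriv x (Y x) u + h.squashedDifference x (Y x) u)) := by
  have hJY := (smoothEndAt_reversedOn (h.proj.smooth x)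
    (h.kahler.almostHermitian.smooth x)).mdiffAt_apply hY
  have hdiff : reversedOn P J x (h.squashedDifference x (Y x) u) =
      J x (h.squashedDifference x (Y x) u) := by
    rw [reversedOn_apply, h.proj_squashedDifference, smul_zero, sub_zero]
  rw [covDerivEnd, sub_apply, ContinuousLinearMap.comp_apply, h.leviCivita_squashing_apply hg' hJY,
    h.leviCivita_squashing_apply hg' hY, h.leviCivita_reversedOn_apply hY,
    h.squashedDifference_reversedOn, map_add, hdiff, map_smul, map_add]
  module

theorem isNearlyKahler (h : IsKahlerFoliation g J P) (hg' : IsSquashing g P g') :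
    IsNearlyKahler g' (reversedOn P J) where
  almostHermitian :=
    isAlmostHermitian_reversedOn hg' h.proj h.kahler.almostHermitian h.comm
  skew x X hX := by
    have hskew := h.projDeriv_compl_skew (X x) (X x)
    rw [eq_neg_iff_add_eq_zero, ← two_smul ℝ, smul_eq_zero_iff_right two_ne_zero, map_sub,
      sub_apply, sub_eq_zero] at hskew
    rw [h.covDerivEnd_reversedOn hg' hX, squashedDifference_apply, ← hskew]
    convert map_zero (J x) using 2
    module

theorem canonicalHermitian_eq_splitConnection (h : IsKahlerFoliation g J P)
    (hg' : IsSquashing g P g') (x : M) (Y : Π y : M, TangentSpace 𝓘(ℝ, E) y)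
    (hY : MDiffAt (T% Y) x) :
    canonicalHermitian g' (reversedOn P J) Y x = splitConnection (leviCivita g) P Y x := by
  ext u
  have hJY := (smoothEndAt_reversedOn (h.proj.smooth x)
    (h.kahler.almostHermitian.smooth x)).mdiffAt_apply hY
  have hrev : J x (h.projDeriv x (reversedOn P J x (Y x)) u) =
      -h.projDeriv x (Y x - (2 : ℝ) • P x (Y x)) u := by
    rw [reversedOn_apply, h.projDeriv_J, h.kahler.almostHermitian.sq]
  have hdiff : J x (h.squashedDifference x (reversedOn P J x (Y x)) u) =
      h.squashedDifference x (Y x) u := by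
    rw [h.squashedDifference_reversedOn, map_neg, h.kahler.almostHermitian.sq, neg_neg]
  have hsplit : splitConnection (leviCivita g) P Y x u =
      leviCivita g Y x u + h.projDeriv x (Y x - (2 : ℝ) • P x (Y x)) u :=
    splitConnection_apply (h.proj.smooth x) h.proj.idem _ hY u
  rw [hsplit, canonicalHermitian, add_apply, smul_apply, h.leviCivita_squashing_apply hg' hY,
    h.covDerivEnd_reversedOn hg' hJY, map_smul, map_add, hrev, hdiff]
  module

end IsKahlerFoliation

end NearlyKahler

section Pushforward

variable {E : Type*} [NormedAddCommGroup E] [NormedSpace ℝ E]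
  {M : Type*} [TopologicalSpace M] [ChartedSpace E M]
  {EN : Type*} [NormedAddCommGroup EN] [NormedSpace ℝ EN]
  {N : Type*} [TopologicalSpace N] [ChartedSpace EN N] [IsManifold 𝓘(ℝ, EN) ∞ N]

theorem tangentTriv_eq_mfderiv_extChartAt {q₀ q : N} (hq : q ∈ (chartAt EN q₀).source)
    (w : TangentSpace 𝓘(ℝ, EN) q) :
    (tangentTriv EN q₀ ⟨q, w⟩).2 =
      mfderiv 𝓘(ℝ, EN) 𝓘(ℝ, EN) (extChartAt 𝓘(ℝ, EN) q₀) q w := by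
  have : IsManifold 𝓘(ℝ, EN) 1 N := .of_le (n := ∞) (by simp)
  rw [← TangentBundle.continuousLinearMapAt_trivializationAt hq]
  exact (Trivialization.continuousLinearMapAt_apply_of_mem (R := ℝ) _ (by simpa using hq)
    w).symm

variable {p : M → N} {x : M}

theorem eventually_mvfderiv_extChartAt_comp (hp : ContMDiff 𝓘(ℝ, E) 𝓘(ℝ, EN) ∞ p) (x : M) :
    ∀ᶠ y in nhds x, ∀ u : TangentSpace 𝓘(ℝ, E) y,
      d% (fun y => extChartAt 𝓘(ℝ, EN) (p x) (p y)) y u =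
        (tangentTriv EN (p x) ⟨p y, mfderiv 𝓘(ℝ, E) 𝓘(ℝ, EN) p y u⟩).2 := by
  have : IsManifold 𝓘(ℝ, EN) 1 N := .of_le (n := ∞) (by simp)
  filter_upwards [hp.continuous.continuousAt.eventually
    ((chartAt EN (p x)).open_source.mem_nhds (mem_chart_source EN (p x)))] with y hy u
  have hcomp : HasMFDerivAt 𝓘(ℝ, E) 𝓘(ℝ, EN) (fun y => extChartAt 𝓘(ℝ, EN) (p x) (p y)) y _ :=
    HasMFDerivAt.comp y (mdifferentiableAt_extChartAt hy).hasMFDerivAt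
      ((hp y).mdifferentiableAt (by simp)).hasMFDerivAt
  rw [tangentTriv_eq_mfderiv_extChartAt hy, mvfderiv, hcomp.mfderiv]
  rfl

/-- The vector field `y ↦ dp (X y)` along `p`, in the trivialization centered at `p x`. -/
def pushCoord (p : M → N) (X : Π y : M, TangentSpace 𝓘(ℝ, E) y) (x y : M) : EN :=
  (tangentTriv EN (p x) ⟨p y, mfderiv 𝓘(ℝ, E) 𝓘(ℝ, EN) p y (X y)⟩).2

variable {X W : Π y : M, TangentSpace 𝓘(ℝ, E) y}

theorem pushCoord_eventuallyEq_zero (hp : ContMDiff 𝓘(ℝ, E) 𝓘(ℝ, EN) ∞ p)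
    (hW : ∀ y, mfderiv 𝓘(ℝ, E) 𝓘(ℝ, EN) p y (W y) = 0) :
    (pushCoord p W x : M → EN) =ᶠ[nhds x] fun _ => 0 := by
  filter_upwards [hp.continuous.continuousAt.eventually
    (tangentTriv_baseSet_mem_nhds EN (p x))] with y hy
  rw [pushCoord, hW, ← Trivialization.continuousLinearMapAt_apply_of_mem (R := ℝ) _ hy, map_zero]

variable [IsManifold 𝓘(ℝ, E) ∞ M]

theorem mdifferentiableAt_pushCoord (hp : ContMDiff 𝓘(ℝ, E) 𝓘(ℝ, EN) ∞ p)
    (hX : MDiffAt (T% X) x) : MDiffAt (pushCoord p X x : M → EN) x := by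
  have hpX : MDiffAt (fun y => TotalSpace.mk' EN (E := fun q : N => TangentSpace 𝓘(ℝ, EN) q) (p y)
      (mfderiv 𝓘(ℝ, E) 𝓘(ℝ, EN) p y (X y))) x :=
    ((hp.contMDiff_tangentMap (m := ∞) (by simp)).contMDiffAt.mdifferentiableAt
      (by simp)).comp x hX
  exact ((mdifferentiableAt_totalSpace 𝓘(ℝ, EN) _).1 hpX).2

theorem mfderiv_mlieBracket_of_vertical [CompleteSpace E] (hp : ContMDiff 𝓘(ℝ, E) 𝓘(ℝ, EN) ∞ p)
    (hX : MDiffAt (T% X) x) (hW : MDiffAt (T% W) x)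
    (hWv : ∀ y, mfderiv 𝓘(ℝ, E) 𝓘(ℝ, EN) p y (W y) = 0) :
    mfderiv 𝓘(ℝ, E) 𝓘(ℝ, EN) p x (mlieBracket 𝓘(ℝ, E) X W x) =
      -(tangentTriv EN (p x)).symm (p x) (d% (pushCoord p X x : M → EN) x (W x)) := by
  have hf : ContMDiffAt 𝓘(ℝ, E) 𝓘(ℝ, EN) ∞ (fun y => extChartAt 𝓘(ℝ, EN) (p x) (p y)) x :=
    (contMDiffAt_extChartAt (x := p x)).comp x (hp x)
  have hdf := eventually_mvfderiv_extChartAt_comp hp x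
  have hfZ : ∀ Z : Π y : M, TangentSpace 𝓘(ℝ, E) y,
      (fun y => d% (fun y => extChartAt 𝓘(ℝ, EN) (p x) (p y)) y (Z y)) =ᶠ[nhds x]
        pushCoord p Z x := fun Z => hdf.mono fun y hy => hy (Z y)
  have hXW : d% (fun y => d% (fun y => extChartAt 𝓘(ℝ, EN) (p x) (p y)) y (W y)) x (X x) = 0 := by
    rw [mvfderiv, ((hasMFDerivAt_const (0 : EN) x).congr_of_eventuallyEq
      ((hfZ W).trans (pushCoord_eventuallyEq_zero hp hWv))).mfderiv]
    rfl
  have hWX : d% (fun y => d% (fun y => extChartAt 𝓘(ℝ, EN) (p x) (p y)) y (X y)) x (W x) =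
      d% (pushCoord p X x : M → EN) x (W x) := by
    rw [mvfderiv, ((mdifferentiableAt_pushCoord hp hX).hasMFDerivAt.congr_of_eventuallyEq
      (hfZ X)).mfderiv]
    rfl
  have hbracket := mvfderiv_mlieBracket hf hX hW
  rw [hXW, hWX, zero_sub] at hbracket
  have hsymm := congrArg ((tangentTriv EN (p x)).symm (p x))
    ((hdf.self_of_nhds (mlieBracket 𝓘(ℝ, E) X W x)).symm.trans hbracket)
  have hpx : p x ∈ (tangentTriv EN (p x)).baseSet := mem_baseSet_trivializationAt' (p x)
  rwa [Trivialization.symm_apply_apply_mk _ hpx, ← Trivialization.symmL_apply (R := ℝ) _ hpx,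
    map_neg, Trivialization.symmL_apply (R := ℝ) _ hpx] at hsymm

theorem mvfderiv_apply_mfderiv_self {B : BilinField EN N} (hB : SmoothBilinAt B (p x))
    (hsymm : ∀ u v, B (p x) u v = B (p x) v u) (hp : ContMDiff 𝓘(ℝ, E) 𝓘(ℝ, EN) ∞ p)
    (hX : MDiffAt (T% X) x) {w : TangentSpace 𝓘(ℝ, E) x}
    (hw : mfderiv 𝓘(ℝ, E) 𝓘(ℝ, EN) p x w = 0) :
    d% (fun y => B (p y) (mfderiv 𝓘(ℝ, E) 𝓘(ℝ, EN) p y (X y))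
        (mfderiv 𝓘(ℝ, E) 𝓘(ℝ, EN) p y (X y))) x w =
      2 * B (p x) ((tangentTriv EN (p x)).symm (p x) (d% (pushCoord p X x : M → EN) x w))
        (mfderiv 𝓘(ℝ, E) 𝓘(ℝ, EN) p x (X x)) := by
  have hcoord := hasMFDerivWithinAt_univ.2 (mdifferentiableAt_pushCoord hp hX).hasMFDerivAt
  obtain ⟨f', hf', hf'_apply⟩ := hB.exists_hasMFDerivWithinAt_along
    (hasMFDerivWithinAt_univ.2 ((hp x).mdifferentiableAt (by simp)).hasMFDerivAt)
    _ _ hcoord hcoord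
  rw [Set.insert_eq_of_mem (Set.mem_univ x)] at hf'
  replace hf' := hasMFDerivWithinAt_univ.1 hf'
  have hw_apply : ∀ L : TangentSpace 𝓘(ℝ, EN) (p x) →L[ℝ] ℝ,
      L (mfderiv 𝓘(ℝ, E) 𝓘(ℝ, EN) p x w) = 0 := fun L => by rw [hw, map_zero]
  rw [mvfderiv, hf'.mfderiv]
  exact (hf'_apply w).trans ((congrArg₂ (· + ·)
    ((congrArg₂ (· + ·) (hw_apply _) rfl).trans (zero_add _)) (hsymm _ _)).trans
    (two_mul _).symm)

end Pushforward

section RiemannianSubmersion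

variable {E : Type*} [NormedAddCommGroup E] [NormedSpace ℝ E] [FiniteDimensional ℝ E]
  {M : Type*} [TopologicalSpace M] [ChartedSpace E M] [IsManifold 𝓘(ℝ, E) ∞ M]
  {EN : Type*} [NormedAddCommGroup EN] [NormedSpace ℝ EN] [FiniteDimensional ℝ EN]
  {N : Type*} [TopologicalSpace N] [ChartedSpace EN N] [IsManifold 𝓘(ℝ, EN) ∞ N]
  {g : RiemMetric E M} {gN : RiemMetric EN N} {p : M → N} {x : M} {u : TangentSpace 𝓘(ℝ, E) x}

theorem verticalProj_eq_zero_iff :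
    verticalProj EN g p x u = 0 ↔ u ∈ horizontalSpace EN g p x :=
  Submodule.projection_apply_eq_zero_iff (isCompl_vertical_horizontal EN g p x)

theorem verticalProj_eq_self_iff :
    verticalProj EN g p x u = u ↔ u ∈ verticalSpace E EN p x :=
  ⟨fun hu => hu ▸ verticalProj_mem EN g p x u,
    Submodule.projection_apply_of_mem_left (isCompl_vertical_horizontal EN g p x)⟩

theorem horizontalSpace_eq_ker :
    horizontalSpace EN g p = fun x => LinearMap.ker (verticalProj EN g p x).toLinearMap :=
  funext fun _ => Submodule.ext fun _ => verticalProj_eq_zero_iff.symm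

theorem verticalSpace_eq_ker (g : RiemMetric E M) :
    verticalSpace E EN p = fun x => LinearMap.ker (horizontalProj EN g p x).toLinearMap :=
  funext fun _ => Submodule.ext fun _ =>
    (sub_eq_zero.trans (eq_comm.trans verticalProj_eq_self_iff)).symm

theorem verticalProj_comm {L : TangentSpace 𝓘(ℝ, E) x →L[ℝ] TangentSpace 𝓘(ℝ, E) x}
    (hV : ∀ u ∈ verticalSpace E EN p x, L u ∈ verticalSpace E EN p x)
    (hH : ∀ u ∈ horizontalSpace EN g p x, L u ∈ horizontalSpace EN g p x)
    (u : TangentSpace 𝓘(ℝ, E) x) :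
    verticalProj EN g p x (L u) = L (verticalProj EN g p x u) := by
  conv_lhs => rw [← proj_add EN g p x u, map_add, map_add]
  rw [verticalProj_eq_self_iff.2 (hV _ (verticalProj_mem EN g p x u)),
    verticalProj_eq_zero_iff.2 (hH _ (horizontalProj_mem EN g p x u)), add_zero]

theorem inner_verticalProj_left (u v : TangentSpace 𝓘(ℝ, E) x) :
    g.inner x (verticalProj EN g p x u) v =
      g.inner x (verticalProj EN g p x u) (verticalProj EN g p x v) := by
  conv_lhs => rw [← proj_add EN g p x v, map_add]
  rw [horizontalProj_mem EN g p x v _ (verticalProj_mem EN g p x u), add_zero]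

theorem inner_verticalProj_comm (u v : TangentSpace 𝓘(ℝ, E) x) :
    g.inner x (verticalProj EN g p x u) v = g.inner x u (verticalProj EN g p x v) := by
  rw [inner_verticalProj_left, g.symm x u, inner_verticalProj_left v u, g.symm]

namespace IsRiemannianSubmersion

theorem isSquashing (hp : IsRiemannianSubmersion g gN p) :
    IsSquashing g (verticalProj EN g p) (squashedMetric g gN p hp) := fun x u v => by
  change squashedInner EN g p x u v = _
  rw [squashedInner_apply, inner_eq_proj EN g p x u v, inner_verticalProj_left u v]
  ring

theorem smoothEndAt_verticalProj (hp : IsRiemannianSubmersion g gN p) (x : M) :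
    SmoothEndAt (verticalProj EN g p) x := by
  let Q : EndField E M := fun y =>
    ContinuousLinearMap.id ℝ (TangentSpace 𝓘(ℝ, E) y) - (1 / 2 : ℝ) • verticalProj EN g p y
  have hQ : SmoothEndAt Q x :=
    smoothEndAt_of_inner g ((squashedMetric g gN p hp).smoothBilinAt x) fun y u v => by
      rw [hp.isSquashing y u v]
      simp only [Q, sub_apply, smul_apply, ContinuousLinearMap.id_apply, map_sub, map_smul,
        smul_eq_mul]
  have hP : verticalProj EN g p = fun y => (2 : ℝ) • (ContinuousLinearMap.id ℝ _ - Q y) := by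
    funext y
    rw [sub_sub_cancel, smul_smul, mul_one_div_cancel two_ne_zero, one_smul]
  rw [hP]
  exact ((smoothEndAt_id x).sub hQ).const_smul 2

theorem isOrthogonalProjection (hp : IsRiemannianSubmersion g gN p) :
    IsOrthogonalProjection g (verticalProj EN g p) where
  smooth := hp.smoothEndAt_verticalProj
  idem x u := verticalProj_eq_self_iff.2 (verticalProj_mem EN g p x u)
  symm _ := inner_verticalProj_comm

theorem inner_horizontal (hp : IsRiemannianSubmersion g gN p) (u : TangentSpace 𝓘(ℝ, E) x)
    {v : TangentSpace 𝓘(ℝ, E) x} (hv : v ∈ horizontalSpace EN g p x) :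
    g.inner x u v = gN.inner (p x) (mfderiv 𝓘(ℝ, E) 𝓘(ℝ, EN) p x u)
      (mfderiv 𝓘(ℝ, E) 𝓘(ℝ, EN) p x v) := by
  have hvertical : mfderiv 𝓘(ℝ, E) 𝓘(ℝ, EN) p x (verticalProj EN g p x u) = 0 :=
    verticalProj_mem EN g p x u
  rw [← proj_add EN g p x u, map_add, map_add, hvertical, zero_add, add_apply,
    hv _ (verticalProj_mem EN g p x u), zero_add,
    hp.isometry x _ (horizontalProj_mem EN g p x u) _ hv]

/- The function `g(X, X)` is the pullback of `g_N(dp X, dp X)`, and `dp [X, W]` is minus the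
derivative of `dp X` along `W`, so that `W (g(X, X)) = -2 g([X, W], X)`. -/
theorem inner_leviCivita_vertical (hp : IsRiemannianSubmersion g gN p)
    {W : Π y : M, TangentSpace 𝓘(ℝ, E) y} (hW : MDiffAt (T% W) x)
    (hWv : ∀ y, W y ∈ verticalSpace E EN p y) (hu : u ∈ horizontalSpace EN g p x) :
    g.inner x (leviCivita g W x u) u = 0 := by
  have : CompleteSpace E := FiniteDimensional.complete ℝ E
  let X : Π y : M, TangentSpace 𝓘(ℝ, E) y := fun y => horizontalProj EN g p y (extend E u y)
  have hX : MDiffAt (T% X) x :=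
    (hp.isOrthogonalProjection.compl.smooth x).mdiffAt_apply (mdifferentiableAt_extend ..)
  have hXu : X x = u := by
    simp only [X, extend_apply_self, horizontalProj, sub_apply, ContinuousLinearMap.id_apply,
      verticalProj_eq_zero_iff.2 hu, sub_zero]
  have hXX : (fun y => g.inner y (X y) (X y)) = fun y => gN.inner (p y)
      (mfderiv 𝓘(ℝ, E) 𝓘(ℝ, EN) p y (X y)) (mfderiv 𝓘(ℝ, E) 𝓘(ℝ, EN) p y (X y)) :=
    funext fun y => hp.inner_horizontal _ (horizontalProj_mem EN g p y _)
  have hmetric := (leviCivita_isLeviCivita g).metric x X X (W x) hX hX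
  rw [hXX, mvfderiv_apply_mfderiv_self (gN.smoothBilinAt (p x)) (gN.symm (p x)) hp.smooth hX
    (hWv x), hXu, g.symm x u] at hmetric
  have hbracket := hp.inner_horizontal (mlieBracket 𝓘(ℝ, E) X W x) hu
  rw [mfderiv_mlieBracket_of_vertical hp.smooth hX hW hWv,
    ← (leviCivita_isLeviCivita g).sub_eq_mlieBracket hX hW, hXu] at hbracket
  simp only [map_sub, map_neg, sub_apply, neg_apply] at hbracket
  linarith

theorem isKahlerFoliation (hp : IsRiemannianSubmersion g gN p)
    (hgeo : HasTotallyGeodesicFibers EN g p) {J : EndField E M} (hJ : IsKahler g J)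
    (hV : ∀ x, ∀ u ∈ verticalSpace E EN p x, J x u ∈ verticalSpace E EN p x)
    (hH : ∀ x, ∀ u ∈ horizontalSpace EN g p x, J x u ∈ horizontalSpace EN g p x) :
    IsKahlerFoliation g J (verticalProj EN g p) where
  proj := hp.isOrthogonalProjection
  kahler := hJ
  comm x := verticalProj_comm (hV x) (hH x)
  totallyGeodesic x W hW hWv u hu := verticalProj_eq_self_iff.2 <|
    hgeo x W hW (fun y => verticalProj_eq_self_iff.1 (hWv y)) u (verticalProj_eq_self_iff.1 hu)
  bundleLike _ _ hW hWv _ hu := hp.inner_leviCivita_vertical hW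
    (fun y => verticalProj_eq_self_iff.1 (hWv y)) (verticalProj_eq_zero_iff.1 hu)

end IsRiemannianSubmersion

end RiemannianSubmersion

section VerticalSpace

variable {E : Type*} [NormedAddCommGroup E] [NormedSpace ℝ E]
  {M : Type*} [TopologicalSpace M] [ChartedSpace E M]
  {EN : Type*} [NormedAddCommGroup EN] [NormedSpace ℝ EN] [FiniteDimensional ℝ EN]
  {N : Type*} [TopologicalSpace N] [ChartedSpace EN N] {p : M → N} {x : M}

theorem verticalSpace_ne_top (hsurj : Function.Surjective (mfderiv 𝓘(ℝ, E) 𝓘(ℝ, EN) p x))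
    (hpos : 0 < Module.finrank ℝ EN) : verticalSpace E EN p x ≠ ⊤ := by
  intro htop
  obtain ⟨w, hw⟩ := (Module.finrank_pos_iff_exists_ne_zero (R := ℝ) (M := EN)).1 hpos
  obtain ⟨u, hu⟩ := hsurj w
  have hmem : u ∈ verticalSpace E EN p x := htop ▸ Submodule.mem_top
  exact hw (hu.symm.trans hmem)

theorem verticalSpace_ne_bot [FiniteDimensional ℝ E]
    (hlt : Module.finrank ℝ EN < Module.finrank ℝ E) : verticalSpace E EN p x ≠ ⊥ := by
  have : FiniteDimensional ℝ (TangentSpace 𝓘(ℝ, E) x) := inferInstanceAs (FiniteDimensional ℝ E)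
  have : FiniteDimensional ℝ (TangentSpace 𝓘(ℝ, EN) (p x)) :=
    inferInstanceAs (FiniteDimensional ℝ EN)
  exact LinearMap.ker_ne_bot_of_finrank_lt hlt

end VerticalSpace

end

theorem proposition3p1
    {E : Type*} [NormedAddCommGroup E] [NormedSpace ℝ E] [FiniteDimensional ℝ E]
    {M : Type*} [TopologicalSpace M] [ChartedSpace E M] [IsManifold 𝓘(ℝ, E) ∞ M]
    {EN : Type*} [NormedAddCommGroup EN] [NormedSpace ℝ EN] [FiniteDimensional ℝ EN]
    {N : Type*} [TopologicalSpace N] [ChartedSpace EN N] [IsManifold 𝓘(ℝ, EN) ∞ N]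
    (g : RiemMetric E M) (gN : RiemMetric EN N) (p : M → N)
    (hp : IsRiemannianSubmersion g gN p) (hgeo : HasTotallyGeodesicFibers EN g p)
    (J : EndField E M) (hJ : IsKahler g J)
    (hV : ∀ x, ∀ u ∈ verticalSpace E EN p x, J x u ∈ verticalSpace E EN p x)
    (hH : ∀ x, ∀ u ∈ horizontalSpace EN g p x, J x u ∈ horizontalSpace EN g p x) :
    IsNearlyKahler (squashedMetric g gN p hp) (reversedJ EN g p J) ∧
    IsParallelDistribution
      (canonicalHermitian (squashedMetric g gN p hp) (reversedJ EN g p J))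
      (verticalSpace E EN p) ∧
    IsParallelDistribution
      (canonicalHermitian (squashedMetric g gN p hp) (reversedJ EN g p J))
      (horizontalSpace EN g p) ∧
    (∀ x, ∀ τ ∈ holonomyGroup
        (canonicalHermitian (squashedMetric g gN p hp) (reversedJ EN g p J)) x,
      (∀ u ∈ verticalSpace E EN p x, τ u ∈ verticalSpace E EN p x) ∧
      (∀ u ∈ horizontalSpace EN g p x, τ u ∈ horizontalSpace EN g p x)) ∧
    (0 < Module.finrank ℝ EN → Module.finrank ℝ EN < Module.finrank ℝ E →
      HasReducibleHolonomy
        (canonicalHermitian (squashedMetric g gN p hp) (reversedJ EN g p J))) := by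
  have hfol := hp.isKahlerFoliation hgeo hJ hV hH
  have hsplit := hfol.canonicalHermitian_eq_splitConnection hp.isSquashing
  have hsplit_compl := hsplit
  rw [← splitConnection_complField] at hsplit_compl
  have hvert : ∀ x, ∀ τ ∈ holonomyGroup
      (canonicalHermitian (squashedMetric g gN p hp) (reversedJ EN g p J)) x,
      ∀ u ∈ verticalSpace E EN p x, τ u ∈ verticalSpace E EN p x := fun x τ hτ u hu => by
    rw [verticalSpace_eq_ker g] at hu ⊢
    exact hfol.proj.compl.holonomyGroup_preserves_ker (leviCivita_isLeviCivita g) hsplit_compl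
      hτ hu
  refine ⟨hfol.isNearlyKahler hp.isSquashing, ?_, ?_, fun x τ hτ => ⟨hvert x τ hτ, ?_⟩,
    fun hpos hlt x => ⟨verticalSpace E EN p x, verticalSpace_ne_bot hlt,
      verticalSpace_ne_top (hp.surjective_mfderiv x) hpos, hvert x⟩⟩
  · rw [verticalSpace_eq_ker g]
    exact isParallelDistribution_ker hfol.proj.compl.idem (leviCivita g) hsplit_compl
  · rw [horizontalSpace_eq_ker]
    exact isParallelDistribution_ker hfol.proj.idem (leviCivita g) hsplit
  · intro u hu
    rw [horizontalSpace_eq_ker] at hu ⊢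
    exact hfol.proj.holonomyGroup_preserves_ker (leviCivita_isLeviCivita g) hsplit hτ hu
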